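/- Let $l,N\ge 1$ and let $\mathbb G\subset\mathbb R^l$ be a measurable region of finite volume. A target is at $z_T\in\mathbb R^l$ and has detection radius $R>0$; always assume that the closed ball $\mathcal B_{2R}(z_T)$ is contained in $\mathbb G$ (call such $(z_T,R)$ admissible). $N$ sensors are placed independently and uniformly in $\mathbb G$; exactly those in $\mathcal B_R(z_T)$ detect the target, and the observation is the vector $Z=(z_1,\dots,z_n)$ of locations of the detecting sensors. All probabilities are conditional on $n\ge 1$. For $r>0$ let $\mathcal T(Z,r)=\bigcap_{i=1}^n\mathcal B_r(z_i)$, and let $g_r(Z)=CM(\mathcal T(Z,r))$ be its center of mass; where $\mathcal T(Z,r)$ has zero volume (which can have positive probability only if $r<R$), put $g_r(Z)=\frac1n\sum_i z_i$. Estimators are the measurable functions $g$ of $Z$ that shift with the data: $g(z_1+d,\dots,z_n+d)=g(z_1,\dots,z_n)+d$ for all $d\in\mathbb R^l$ and $n\ge1$. For a set $\Theta$ of admissible parameters, an estimator is unbiased on $\Theta$ if $E_{z_T,R}[g(Z)]=z_T$ for all $(z_T,R)\in\Theta$, and it is an MVU estimator of $z_T$ on $\Theta$ if it is unbiased on $\Theta$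 and $E_{z_T,R}\|g(Z)-z_T\|^2\le E_{z_T,R}\|h(Z)-z_T\|^2$ for every estimator $h$ that is unbiased on $\Theta$ and every $(z_T,R)\in\Theta$. 1. For every $r>0$, $g_r$ is unbiased on the set of all admissible $(z_T,R)$, whatever the true radius $R$. Moreover, for every admissible $(z_T,R)$ the event that $\mathcal T(Z,r)$ has positive volume has positive probability, conditionally on it $CM(\mathcal T(Z,r))$ has expectation $z_T$, and it has probability one if $R\le r$. 2. For every known radius $R>0$, $g_R$ is an MVU estimator of $z_T$ on $\{(z_T,R)\text{ admissible}\}$, and it is unique: every MVU estimator on this set equals $CM(\mathcal T(Z,R))$ almost surely under each of its parameters. 3. Let $l\ge2$ and $N\ge3$, and let $R_1\ne R_2$ be two radii for each of which there is an admissible parameter. Then, under every admissible $(z_T,R)$ with $R\in\{R_1,R_2\}$, with positive probability both $\mathcal T(Z,R_1)$ and $\mathcal T(Z,R_2)$ have positive volume and $CM(\mathcal T(Z,R_1))\neq CM(\mathcal T(Z,R_2))$. Moreover, when $R$ is unknown there is no MVU estimator of $z_T$: for every set $\rho$ of radii containing $R_1$ and $R_2$, no estimator is MVU on $\{(z_T,R)\text{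 admissible}: R\in\rho\}$. -/

import Mathlib

open MeasureTheory ProbabilityTheory
open scoped ENNReal

noncomputable section

/-- Points of `l`-dimensional Euclidean space. -/
abbrev Loc (l : ℕ) := EuclideanSpace ℝ (Fin l)

/-- The possible target region `T(Z, R)`: the intersection of the balls of radius `R` around the
reported sensor locations `Z = (z₁, …, zₙ)`. -/
def possibleRegion {l n : ℕ} (R : ℝ) (Z : Fin n → Loc l) : Set (Loc l) :=
  ⋂ i, Metric.closedBall (Z i) R

/-- The center of mass of a set (with respect to Lebesgue measure). It is meaningful for sets of
positive finite volume. -/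
def centerOfMass {l : ℕ} (A : Set (Loc l)) : Loc l := ⨍ x in A, x ∂volume

/-- An estimator assigns a point to every vector of reported locations, of any length. -/
abbrev Estimator (l : ℕ) := (n : ℕ) → (Fin n → Loc l) → Loc l

/-- The estimator `Z ↦ CM(T(Z, R))`. The region `T(Z, R)` may be empty when `R` is smaller than the
true detection radius; where it has zero volume, so that its center of mass is undefined, the
estimator returns the arithmetic mean of the reported locations. -/
def cmEstimator {l : ℕ} (R : ℝ) : Estimator l := fun n Z =>
  open Classical in
  if volume (possibleRegion R Z) = 0 then (n : ℝ)⁻¹ • ∑ i, Z i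
  else centerOfMass (possibleRegion R Z)

/-- Admissible estimators: measurable, and shifting along with the data. (There is always at least
one report, so the vector of length zero plays no role.) -/
structure IsEquivariantEstimator {l : ℕ} (g : Estimator l) : Prop where
  measurable : ∀ n, Measurable (g n)
  shift : ∀ n, 0 < n → ∀ (Z : Fin n → Loc l) (d : Loc l), g n (fun i => Z i + d) = g n Z + d

/-- The indices of the sensors that detect a target at `z`, for the detection radius `R` and the
sensor locations `ω`. -/
def detecting {l N : ℕ} (z : Loc l) (R : ℝ) (ω : Fin N → Loc l) : Finset (Fin N) :=
  open Classical in
  Finset.univ.filter fun i => ω i ∈ Metric.closedBall z R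

/-- The observation `Z`: the vector of locations of the detecting sensors, in the order of their
indices. -/
def reported {l N : ℕ} (z : Loc l) (R : ℝ) (ω : Fin N → Loc l) :
    Fin (detecting z R ω).card → Loc l :=
  fun i => ω ((detecting z R ω).orderEmbOfFin rfl i)

/-- The value of the estimator `g` at the observation. -/
def estimate {l N : ℕ} (g : Estimator l) (z : Loc l) (R : ℝ) (ω : Fin N → Loc l) : Loc l :=
  g (detecting z R ω).card (reported z R ω)

/-- The law of `N` sensors placed independently and uniformly in `G`, conditioned on at least one
of them detecting the target at `z` with detection radius `R`. -/
def sensorLaw {l : ℕ} (N : ℕ) (G : Set (Loc l)) (z : Loc l) (R : ℝ) : Measure (Fin N → Loc l) :=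
  (Measure.pi fun _ : Fin N => volume[|G])[|{ω | (detecting z R ω).Nonempty}]

/-- The parameters `(z, R)` with detection radius in `ρ` and target well inside `G`. -/
def paramSet {l : ℕ} (G : Set (Loc l)) (ρ : Set ℝ) : Set (Loc l × ℝ) :=
  {θ | θ.2 ∈ ρ ∧ 0 < θ.2 ∧ Metric.closedBall θ.1 (2 * θ.2) ⊆ G}

/-- The random point `X` is an unbiased estimate of `z` under the law `μ`. -/
def IsUnbiasedUnder {l : ℕ} {Ω : Type*} [MeasurableSpace Ω] (μ : Measure Ω) (X : Ω → Loc l)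
    (z : Loc l) : Prop :=
  Integrable X μ ∧ ∫ ω, X ω ∂μ = z

/-- `E ‖g(Z) - z‖²`, possibly infinite. For an unbiased estimator this is its (total) variance. -/
def meanSquare {l : ℕ} (N : ℕ) (G : Set (Loc l)) (g : Estimator l) (z : Loc l) (R : ℝ) : ℝ≥0∞ :=
  ∫⁻ ω, ‖estimate g z R ω - z‖ₑ ^ 2 ∂(sensorLaw N G z R)

/-- `g` is a shift-equivariant estimator that is unbiased for the target location at every parameter
`(z, R)` in `Θ`. -/
def IsUnbiasedOn {l : ℕ} (N : ℕ) (G : Set (Loc l)) (Θ : Set (Loc l × ℝ)) (g : Estimator l) :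
    Prop :=
  IsEquivariantEstimator g ∧
    ∀ θ ∈ Θ, IsUnbiasedUnder (sensorLaw N G θ.1 θ.2) (estimate g θ.1 θ.2) θ.1

/-- `g` is a minimum variance unbiased (shift-equivariant) estimator of the target location for the
parameter space `Θ`: among the estimators that are unbiased on all of `Θ` it has the smallest
variance at every parameter of `Θ`. -/
def IsMVU {l : ℕ} (N : ℕ) (G : Set (Loc l)) (Θ : Set (Loc l × ℝ)) (g : Estimator l) : Prop :=
  IsUnbiasedOn N G Θ g ∧
    ∀ h : Estimator l, IsUnbiasedOn N G Θ h →
      ∀ θ ∈ Θ, meanSquare N G g θ.1 θ.2 ≤ meanSquare N G h θ.1 θ.2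

end

/-!
Condition on which sensors detect the target at `z`. If these are the sensors in `S`, their
locations are independent and uniform in the ball of radius `R` around `z`, so the law of the
observation is a mixture of uniform laws on the product sets `{Z | z ∈ T(Z, R)}`
(`lintegral_sensorLaw`). These laws are invariant under the reflection of all locations at `z`, and
`CM(T(Z, r))` is reflected with them; hence its law is symmetric about `z`, for every `r`, and it is
unbiased (`isUnbiasedUnder_cond_cmEstimator`).

The uniform laws for the various target positions are shifts of each other. By Fubini's theorem,
averaging a shift-invariant function of `(Z, z)` over `Z` with `z` fixed amounts to averaging over
`z ∈ T(Z, R)` for a vector `Z` with one pinned coordinate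
(`measure_mul_setLIntegral_possibleRegion`). So, given the configuration up to shifts, the target is
uniform in `T(Z, R)`, and by the parallel axis theorem the mean square error of any equivariant `h`
is that of `CM(T(Z, R))` plus the mean square of `h - CM(T(Z, R))` (`meanSquare_eq_add`). This gives
optimality and uniqueness at every single parameter with radius `R`, unbiasedness of `h` not being
needed.

For two radii `r < R`, an MVU estimator would agree almost everywhere with both centers of mass on
a common product of balls. To separate these, take the two endpoints of a diameter and a point
orthogonal to it, on a circle of radius `s r` with `s < 1`; the other locations repeat the third
point. As `s` tends to `1`, the region `T(Z, r)` shrinks to the center of the circle. The region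
`T(Z, R)` tends to a lens symmetric about the center with a piece cut off on one side, so that its
center of mass stays away from the center (`setIntegral_lens_inter_pos`). Centers of mass depend
continuously on `Z`, hence they differ on a set of positive volume.
-/

/-! ### The law of the observation -/

/-- The subvector of `ω` with index set `S`, in the order of the indices. -/
def subvector {l N : ℕ} (S : Finset (Fin N)) (ω : Fin N → Loc l) : Fin S.card → Loc l :=
  fun i => ω (S.orderEmbOfFin rfl i)

theorem measurable_subvector {l N : ℕ} (S : Finset (Fin N)) :
    Measurable (subvector (l := l) S) := by
  unfold subvector
  fun_prop

theorem mem_detecting {l N : ℕ} {z : Loc l} {R : ℝ} {ω : Fin N → Loc l} {i : Fin N} :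
    i ∈ detecting z R ω ↔ ω i ∈ Metric.closedBall z R := by
  simp [detecting]

theorem detecting_eq_iff {l N : ℕ} {z : Loc l} {R : ℝ} {ω : Fin N → Loc l} {S : Finset (Fin N)} :
    detecting z R ω = S ↔ ∀ i, (ω i ∈ Metric.closedBall z R ↔ i ∈ S) := by
  simp [Finset.ext_iff, mem_detecting]

/-- The event that exactly the sensors in `S` detect the target is a product set. -/
theorem setOf_detecting_eq {l N : ℕ} (z : Loc l) (R : ℝ) (S : Finset (Fin N)) :
    {ω : Fin N → Loc l | detecting z R ω = S} = Set.univ.pi fun i =>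
      if i ∈ S then Metric.closedBall z R else (Metric.closedBall z R)ᶜ := by
  ext ω
  simp only [Set.mem_ofPred_eq, detecting_eq_iff, Set.mem_pi, Set.mem_univ, forall_const]
  refine forall_congr' fun i => ?_
  by_cases hi : i ∈ S <;> simp [hi]

theorem measurableSet_detecting_eq {l N : ℕ} (z : Loc l) (R : ℝ) (S : Finset (Fin N)) :
    MeasurableSet {ω : Fin N → Loc l | detecting z R ω = S} := by
  rw [setOf_detecting_eq]
  refine MeasurableSet.univ_pi fun i => ?_
  split_ifs
  · exact measurableSet_closedBall
  · exact measurableSet_closedBall.compl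

theorem apply_reported_eq {l N : ℕ} {β : Type*} (F : (n : ℕ) → (Fin n → Loc l) → β)
    {z : Loc l} {R : ℝ} {ω : Fin N → Loc l} {S : Finset (Fin N)} (h : detecting z R ω = S) :
    F (detecting z R ω).card (reported z R ω) = F S.card (subvector S ω) := by
  subst h; rfl

/-- A family of measurable functions of the vectors of each length is a measurable function of the
observation, although the length of the observation is random. -/
theorem measurable_apply_reported {l N : ℕ} {β : Type*} [MeasurableSpace β]
    {F : (n : ℕ) → (Fin n → Loc l) → β} (hF : ∀ n, Measurable (F n)) (z : Loc l) (R : ℝ) :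
    Measurable fun ω : Fin N → Loc l => F (detecting z R ω).card (reported z R ω) := by
  intro A hA
  have : (fun ω : Fin N → Loc l => F (detecting z R ω).card (reported z R ω)) ⁻¹' A
      = ⋃ S : Finset (Fin N), {ω | detecting z R ω = S} ∩
          (fun ω => F S.card (subvector S ω)) ⁻¹' A := by
    ext ω
    simp only [Set.mem_preimage, Set.mem_iUnion, Set.mem_inter_iff, Set.mem_ofPred_eq]
    constructor
    · intro h
      exact ⟨_, rfl, h⟩
    · rintro ⟨S, hS, h⟩
      rwa [apply_reported_eq F hS]
  rw [this]
  exact MeasurableSet.iUnion fun S => (measurableSet_detecting_eq z R S).inter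
    ((hF _).comp (measurable_subvector S) hA)

theorem measurableSet_reported_mem {l N : ℕ} {A : (n : ℕ) → Set (Fin n → Loc l)}
    (hA : ∀ n, MeasurableSet (A n)) (z : Loc l) (R : ℝ) :
    MeasurableSet {ω : Fin N → Loc l | reported z R ω ∈ A (detecting z R ω).card} :=
  measurableSet_setOfPred.2 (measurable_apply_reported
    (F := fun n Z => Z ∈ A n) (fun n => measurableSet_setOfPred.1 (hA n)) z R)

/-- The marginal of a product of finite measures on a set of coordinates. -/
theorem map_comp_pi_eq_smul {ι κ α : Type*} [Fintype ι] [Fintype κ] [DecidableEq ι]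
    [MeasurableSpace α] (μ : ι → Measure α) [∀ i, IsFiniteMeasure (μ i)] {f : κ → ι}
    (hf : Function.Injective f) :
    (Measure.pi μ).map (fun ω k => ω (f k))
      = (∏ i ∈ (Finset.univ.image f)ᶜ, μ i Set.univ) • Measure.pi fun k => μ (f k) := by
  have key : ∀ s : κ → Set α, (∀ k, MeasurableSet (s k)) →
      (Measure.pi μ).map (fun ω k => ω (f k)) (Set.univ.pi s)
        = (∏ i ∈ (Finset.univ.image f)ᶜ, μ i Set.univ) * ∏ k, μ (f k) (s k) := by
    intro s hs
    rw [Measure.map_apply (by fun_prop) (MeasurableSet.univ_pi hs)]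
    have h1 : (fun (ω : ι → α) k => ω (f k)) ⁻¹' (Set.univ.pi s)
        = Set.univ.pi fun i => ⋂ k ∈ {k | f k = i}, s k := by
      ext ω
      simp only [Set.mem_preimage, Set.mem_pi, Set.mem_univ, forall_const, Set.mem_ofPred_eq,
        Set.mem_iInter]
      exact ⟨fun h i k hk => hk ▸ h k, fun h k => h (f k) k rfl⟩
    rw [h1, Measure.pi_pi, ← Finset.prod_compl_mul_prod (Finset.univ.image f),
      Finset.prod_image fun a _ b _ h => hf h]
    congr 1
    · refine Finset.prod_congr rfl fun i hi => ?_
      congr 1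
      simp only [Finset.mem_compl, Finset.mem_image, Finset.mem_univ, true_and, not_exists] at hi
      simp [hi]
    · refine Finset.prod_congr rfl fun k _ => ?_
      congr 1
      ext x
      simp [hf.eq_iff]
  have hfin : ∀ i, μ i Set.univ ≠ ∞ := fun i => measure_ne_top _ _
  refine ext_of_generate_finite _ generateFrom_pi.symm isPiSystem_pi ?_ ?_
  · rintro _ ⟨s, hs, rfl⟩
    rw [key s fun k => hs k trivial]
    simp [Measure.pi_pi]
  · have := key (fun _ => Set.univ) fun _ => MeasurableSet.univ
    rw [Set.pi_univ] at this
    rw [this]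
    simp [Measure.pi_univ]

theorem setOf_mem_possibleRegion {l n : ℕ} (z : Loc l) (R : ℝ) :
    {Z : Fin n → Loc l | z ∈ possibleRegion R Z}
      = Set.univ.pi fun _ => Metric.closedBall z R := by
  ext Z
  simp [possibleRegion, dist_comm]

theorem pi_uniform_eq_smul {l : ℕ} (N : ℕ) {G : Set (Loc l)} (hGfin : volume G ≠ ∞) :
    (Measure.pi fun _ : Fin N => (volume[|G] : Measure (Loc l)))
      = (volume G)⁻¹ ^ N • Measure.pi fun _ => volume.restrict G := by
  have : IsFiniteMeasure (volume.restrict G) := ⟨by simpa using hGfin.lt_top⟩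
  refine Measure.pi_eq fun s _ => ?_
  simp [ProbabilityTheory.cond, Measure.pi_pi, Finset.prod_mul_distrib]

/-- Given that exactly the sensors in `S` detect the target, the observation is uniformly
distributed in a product of balls. -/
theorem setLIntegral_detecting_eq {l N : ℕ} {G : Set (Loc l)}
    (hGfin : volume G ≠ ∞) {z : Loc l} {R : ℝ} (hB : Metric.closedBall z R ⊆ G)
    (S : Finset (Fin N)) {F : (Fin S.card → Loc l) → ℝ≥0∞} (hF : Measurable F) :
    ∫⁻ ω in {ω | detecting z R ω = S}, F (subvector S ω) ∂(Measure.pi fun _ => volume[|G])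
      = (volume G)⁻¹ ^ N * volume (G \ Metric.closedBall z R) ^ Sᶜ.card *
        ∫⁻ Z in {Z | z ∈ possibleRegion R Z}, F Z := by
  have : IsFiniteMeasure (volume.restrict G) := ⟨by simpa using hGfin.lt_top⟩
  rw [pi_uniform_eq_smul N hGfin, Measure.restrict_smul, lintegral_smul_measure, smul_eq_mul,
    mul_assoc]
  congr 1
  rw [setOf_detecting_eq, Measure.restrict_pi_pi, setOf_mem_possibleRegion, volume_pi,
    Measure.restrict_pi_pi]
  have hmap := map_comp_pi_eq_smul (fun i => (volume.restrict G).restrict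
    (if i ∈ S then Metric.closedBall z R else (Metric.closedBall z R)ᶜ))
    (S.orderEmbOfFin rfl).injective
  have hS : Finset.univ.image (S.orderEmbOfFin rfl) = S := by
    ext i
    simp
  have h1 : ∀ k, (volume.restrict G).restrict
      (if S.orderEmbOfFin rfl k ∈ S then Metric.closedBall z R else (Metric.closedBall z R)ᶜ)
      = volume.restrict (Metric.closedBall z R) := by
    intro k
    rw [if_pos (S.orderEmbOfFin_mem rfl k), Measure.restrict_restrict measurableSet_closedBall,
      Set.inter_eq_left.2 hB]
  have h2 : ∏ i ∈ Sᶜ, (volume.restrict G).restrict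
      (if i ∈ S then Metric.closedBall z R else (Metric.closedBall z R)ᶜ) Set.univ
      = volume (G \ Metric.closedBall z R) ^ Sᶜ.card := by
    rw [← Finset.prod_const]
    refine Finset.prod_congr rfl fun i hi => ?_
    rw [if_neg (Finset.mem_compl.1 hi), Measure.restrict_apply_univ,
      Measure.restrict_apply measurableSet_closedBall.compl, Set.inter_comm, Set.sdiff_eq]
  simp only [h1] at hmap
  rw [hS, h2] at hmap
  rw [← lintegral_map (g := subvector S) hF (measurable_subvector S)]
  change ∫⁻ a, F a ∂(Measure.map (fun (ω : Fin N → Loc l) k => ω (S.orderEmbOfFin rfl k)) _) = _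
  rw [hmap, lintegral_smul_measure, smul_eq_mul]

/-- The weight of the index set `S` in the decomposition of the law of the observation by the set
of detecting sensors: the probability that exactly these sensors detect the target, given that some
sensor does, divided by the volume of the product of balls in which their locations are uniform. -/
noncomputable def detectionWeight {l : ℕ} (N : ℕ) (G : Set (Loc l)) (z : Loc l) (R : ℝ)
    (S : Finset (Fin N)) : ℝ≥0∞ :=
  (Measure.pi (fun _ : Fin N => volume[|G]) {ω | (detecting z R ω).Nonempty})⁻¹ *
    ((volume G)⁻¹ ^ N * volume (G \ Metric.closedBall z R) ^ Sᶜ.card)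

/-- The law of the observation is a mixture of uniform distributions on products of balls. -/
theorem lintegral_sensorLaw {l N : ℕ} {G : Set (Loc l)}
    (hGfin : volume G ≠ ∞) {z : Loc l} {R : ℝ} (hB : Metric.closedBall z R ⊆ G)
    {F : (n : ℕ) → (Fin n → Loc l) → ℝ≥0∞} (hF : ∀ n, Measurable (F n)) :
    ∫⁻ ω, F (detecting z R ω).card (reported z R ω) ∂(sensorLaw N G z R)
      = ∑ S : Finset (Fin N) with S.Nonempty, detectionWeight N G z R S *
        ∫⁻ Z in {Z | z ∈ possibleRegion R Z}, F S.card Z := by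
  have hU : {ω : Fin N → Loc l | (detecting z R ω).Nonempty}
      = ⋃ S ∈ Finset.univ.filter (fun S : Finset (Fin N) => S.Nonempty),
        {ω | detecting z R ω = S} := by
    ext ω; simp
  rw [sensorLaw, ProbabilityTheory.cond, lintegral_smul_measure, smul_eq_mul]
  conv_lhs => rw [hU]
  rw [lintegral_biUnion_finset _ fun S _ => measurableSet_detecting_eq z R S]
  · rw [← hU, Finset.mul_sum]
    refine Finset.sum_congr rfl fun S _ => ?_
    rw [detectionWeight, mul_assoc, ← setLIntegral_detecting_eq hGfin hB S (hF _)]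
    congr 1
    exact setLIntegral_congr_fun (measurableSet_detecting_eq z R S)
      fun ω hω => apply_reported_eq F hω
  · intro S _ T _ hST
    exact Set.disjoint_left.2 fun ω h1 h2 => hST (h1.symm.trans h2)

theorem measure_detecting_nonempty_ne_zero {l N : ℕ} (hN : 1 ≤ N) {G : Set (Loc l)}
    (hGfin : volume G ≠ ∞) {z : Loc l} {R : ℝ} (hR : 0 < R) (hB : Metric.closedBall z R ⊆ G) :
    Measure.pi (fun _ : Fin N => volume[|G]) {ω | (detecting z R ω).Nonempty} ≠ 0 := by
  have hsub : (Set.univ.pi fun _ : Fin N => Metric.closedBall z R)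
      ⊆ {ω | (detecting z R ω).Nonempty} :=
    fun ω hω => ⟨⟨0, hN⟩, mem_detecting.2 (hω _ trivial)⟩
  refine fun h => absurd (measure_mono_null hsub h) ?_
  rw [Measure.pi_pi, cond_apply' measurableSet_closedBall, Set.inter_eq_right.2 hB]
  simp [hGfin, (Metric.measure_closedBall_pos volume z hR).ne']

theorem isProbabilityMeasure_sensorLaw {l N : ℕ} (hN : 1 ≤ N) {G : Set (Loc l)}
    (hGfin : volume G ≠ ∞) {z : Loc l} {R : ℝ} (hR : 0 < R) (hB : Metric.closedBall z R ⊆ G) :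
    IsProbabilityMeasure (sensorLaw N G z R) := by
  exact cond_isProbabilityMeasure (measure_detecting_nonempty_ne_zero hN hGfin hR hB)

/-- With positive probability, all sensors detect the target. -/
theorem detectionWeight_univ_ne_zero {l N : ℕ} {G : Set (Loc l)}
    (hGfin : volume G ≠ ∞) (z : Loc l) (R : ℝ) :
    detectionWeight N G z R Finset.univ ≠ 0 := by
  simp [detectionWeight, hGfin]

/-- Probabilities of events about the observation, in terms of uniform vectors in products of
balls. -/
theorem sensorLaw_apply {l N : ℕ} {G : Set (Loc l)}
    (hGfin : volume G ≠ ∞) {z : Loc l} {R : ℝ} (hB : Metric.closedBall z R ⊆ G)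
    {A : (n : ℕ) → Set (Fin n → Loc l)} (hA : ∀ n, MeasurableSet (A n)) :
    sensorLaw N G z R {ω | reported z R ω ∈ A (detecting z R ω).card}
      = ∑ S : Finset (Fin N) with S.Nonempty, detectionWeight N G z R S *
        volume (A S.card ∩ {Z | z ∈ possibleRegion R Z}) := by
  have hF : ∀ n, Measurable ((A n).indicator (1 : (Fin n → Loc l) → ℝ≥0∞)) :=
    fun n => measurable_one.indicator (hA n)
  have key := lintegral_sensorLaw (N := N) hGfin hB hF
  have hl : ∫⁻ ω, (A (detecting z R ω).card).indicator 1 (reported z R ω) ∂(sensorLaw N G z R)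
      = sensorLaw N G z R {ω | reported z R ω ∈ A (detecting z R ω).card} := by
    rw [← lintegral_indicator_one (measurableSet_reported_mem hA z R)]
    rfl
  rw [← hl, key]
  simp_rw [lintegral_indicator_one (hA _), Measure.restrict_apply (hA _)]

theorem ae_sensorLaw {l N : ℕ} {G : Set (Loc l)}
    (hGfin : volume G ≠ ∞) {z : Loc l} {R : ℝ} (hB : Metric.closedBall z R ⊆ G)
    {A : (n : ℕ) → Set (Fin n → Loc l)} (hA : ∀ n, MeasurableSet (A n))
    (h : ∀ n, 0 < n → ∀ᵐ Z : Fin n → Loc l, z ∈ possibleRegion R Z → Z ∈ A n) :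
    ∀ᵐ ω ∂(sensorLaw N G z R), reported z R ω ∈ A (detecting z R ω).card := by
  refine (sensorLaw_apply (N := N) hGfin hB fun n => (hA n).compl).trans ?_
  refine Finset.sum_eq_zero fun S hS => ?_
  have hS' : 0 < S.card := Finset.card_pos.2 (by simpa using hS)
  have h0 : volume ((A S.card)ᶜ ∩ {Z | z ∈ possibleRegion R Z}) = 0 := by
    refine measure_mono_null (fun Z hZ => ?_) (ae_iff.1 (h _ hS'))
    exact fun hn => hZ.1 (hn hZ.2)
  rw [h0, mul_zero]

/-- Events about the observation have positive probability if they have positive volume for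
vectors of full length. -/
theorem sensorLaw_pos {l N : ℕ} (hN : 1 ≤ N) {G : Set (Loc l)}
    (hGfin : volume G ≠ ∞) {z : Loc l} {R : ℝ} (hB : Metric.closedBall z R ⊆ G)
    {A : (n : ℕ) → Set (Fin n → Loc l)} (hA : ∀ n, MeasurableSet (A n))
    (h : volume (A N ∩ {Z | z ∈ possibleRegion R Z}) ≠ 0) :
    0 < sensorLaw N G z R {ω | reported z R ω ∈ A (detecting z R ω).card} := by
  rw [sensorLaw_apply hGfin hB hA]
  have hne : (Finset.univ : Finset (Fin N)).Nonempty := ⟨⟨0, hN⟩, Finset.mem_univ _⟩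
  refine lt_of_lt_of_le ?_ (Finset.single_le_sum (fun _ _ => zero_le)
    (Finset.mem_filter.2 ⟨Finset.mem_univ _, hne⟩))
  refine pos_iff_ne_zero.2 (mul_ne_zero (detectionWeight_univ_ne_zero hGfin z R) ?_)
  have hcard : (Finset.univ : Finset (Fin N)).card = N := Finset.card_fin N
  rwa [hcard]

/-! ### Possible target regions and their centers of mass -/

theorem mem_possibleRegion {l n : ℕ} {R : ℝ} {Z : Fin n → Loc l} {x : Loc l} :
    x ∈ possibleRegion R Z ↔ ∀ i, dist x (Z i) ≤ R := by
  simp [possibleRegion]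

theorem isClosed_possibleRegion {l n : ℕ} (R : ℝ) (Z : Fin n → Loc l) :
    IsClosed (possibleRegion R Z) :=
  isClosed_iInter fun _ => Metric.isClosed_closedBall

theorem convex_possibleRegion {l n : ℕ} (R : ℝ) (Z : Fin n → Loc l) :
    Convex ℝ (possibleRegion R Z) :=
  convex_iInter fun i => convex_closedBall (Z i) R

theorem possibleRegion_subset_closedBall {l n : ℕ} (R : ℝ) (Z : Fin n → Loc l) (i : Fin n) :
    possibleRegion R Z ⊆ Metric.closedBall (Z i) R :=
  Set.iInter_subset _ i

theorem volume_possibleRegion_ne_top {l n : ℕ} (hn : 0 < n) (R : ℝ) (Z : Fin n → Loc l) :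
    volume (possibleRegion R Z) ≠ ∞ :=
  ((measure_mono (possibleRegion_subset_closedBall R Z ⟨0, hn⟩)).trans_lt
    measure_closedBall_lt_top).ne

theorem integrableOn_id_possibleRegion {l n : ℕ} (hn : 0 < n) (R : ℝ) (Z : Fin n → Loc l) :
    IntegrableOn (fun x => x) (possibleRegion R Z) :=
  (continuous_id.continuousOn.integrableOn_compact (isCompact_closedBall _ _)).mono_set
    (possibleRegion_subset_closedBall R Z ⟨0, hn⟩)

theorem centerOfMass_mem_possibleRegion {l n : ℕ} (hn : 0 < n) {R : ℝ} {Z : Fin n → Loc l}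
    (h : volume (possibleRegion R Z) ≠ 0) :
    centerOfMass (possibleRegion R Z) ∈ possibleRegion R Z :=
  (convex_possibleRegion R Z).set_average_mem (isClosed_possibleRegion R Z) h
    (volume_possibleRegion_ne_top hn R Z)
    ((ae_restrict_iff' (isClosed_possibleRegion R Z).measurableSet).2
      (Filter.Eventually.of_forall fun _ hx => hx))
    (integrableOn_id_possibleRegion hn R Z)

theorem isClosed_setOf_mem_possibleRegion {l n : ℕ} (R : ℝ) :
    IsClosed {p : (Fin n → Loc l) × Loc l | p.2 ∈ possibleRegion R p.1} := by
  simp only [mem_possibleRegion, Set.ofPred_forall]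
  exact isClosed_iInter fun i => isClosed_le (by fun_prop) continuous_const

theorem measurableSet_setOf_mem_possibleRegion {l n : ℕ} (z : Loc l) (R : ℝ) :
    MeasurableSet {Z : Fin n → Loc l | z ∈ possibleRegion R Z} :=
  (isClosed_setOf_mem_possibleRegion R).measurableSet.preimage
    (f := fun Z : Fin n → Loc l => (Z, z)) (by fun_prop)

theorem measurable_volume_possibleRegion {l n : ℕ} (R : ℝ) :
    Measurable fun Z : Fin n → Loc l => volume (possibleRegion R Z) :=
  measurable_measure_prodMk_left
    (isClosed_setOf_mem_possibleRegion (n := n) (l := l) R).measurableSet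

theorem centerOfMass_eq {l : ℕ} (A : Set (Loc l)) :
    centerOfMass A = (volume.real A)⁻¹ • ∫ x in A, x :=
  setAverage_eq _ _ _

theorem setIntegral_possibleRegion_eq {l n : ℕ} (R : ℝ) (Z : Fin n → Loc l) :
    ∫ x in possibleRegion R Z, x = ∫ x, {p : (Fin n → Loc l) × Loc l |
      p.2 ∈ possibleRegion R p.1}.indicator (fun p => p.2) (Z, x) := by
  rw [← integral_indicator (isClosed_possibleRegion R Z).measurableSet]
  rfl

theorem measurable_centerOfMass_possibleRegion {l n : ℕ} (R : ℝ) :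
    Measurable fun Z : Fin n → Loc l => centerOfMass (possibleRegion R Z) := by
  simp only [centerOfMass_eq, setIntegral_possibleRegion_eq]
  refine (measurable_volume_possibleRegion R).ennreal_toReal.inv.smul ?_
  refine (StronglyMeasurable.integral_prod_right ?_).measurable
  exact (measurable_snd.indicator
    (isClosed_setOf_mem_possibleRegion R).measurableSet).stronglyMeasurable

theorem measurableSet_volume_possibleRegion_ne_zero {l n : ℕ} (R : ℝ) :
    MeasurableSet {Z : Fin n → Loc l | volume (possibleRegion R Z) ≠ 0} :=
  (measurableSet_eq_fun (measurable_volume_possibleRegion R) measurable_const).compl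

theorem measurable_cmEstimator {l : ℕ} (R : ℝ) (n : ℕ) :
    Measurable (cmEstimator (l := l) R n) := by
  classical
  unfold cmEstimator
  refine Measurable.ite (measurableSet_eq_fun (measurable_volume_possibleRegion R)
    measurable_const) ?_ (measurable_centerOfMass_possibleRegion R)
  fun_prop

/-- Centers of mass are equivariant under isometries of the space. -/
theorem centerOfMass_preimage_isometry {l : ℕ} (L : Loc l ≃ₗᵢ[ℝ] Loc l) (d : Loc l)
    {A : Set (Loc l)} (hA : IntegrableOn (fun x => x) ((fun x => L x + d) ⁻¹' A))
    (h0 : volume A ≠ 0) (hfin : volume A ≠ ∞) :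
    volume ((fun x => L x + d) ⁻¹' A) = volume A ∧
    centerOfMass A = L (centerOfMass ((fun x => L x + d) ⁻¹' A)) + d := by
  have hmp : MeasurePreserving (fun x => L x + d) (volume : Measure (Loc l)) volume :=
    (measurePreserving_add_right volume d).comp L.measurePreserving
  have he : MeasurableEmbedding fun x => L x + d :=
    (MeasurableEquiv.addRight d).measurableEmbedding.comp
      L.toHomeomorph.measurableEmbedding
  have hv : volume ((fun x => L x + d) ⁻¹' A) = volume A :=
    hmp.measure_preimage_emb he A
  refine ⟨hv, ?_⟩
  have hr : volume.real A ≠ 0 := by simp [Measure.real, ENNReal.toReal_eq_zero_iff, h0, hfin]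
  have hvr : volume.real ((fun x => L x + d) ⁻¹' A) = volume.real A := by
    rw [Measure.real, hv, Measure.real]
  have hi : ∫ x in A, x = L (∫ x in (fun x => L x + d) ⁻¹' A, x) + volume.real A • d := by
    rw [← hmp.setIntegral_preimage_emb he (fun x => x) A, integral_add]
    · rw [setIntegral_const, hvr]
      congr 1
      exact L.toContinuousLinearEquiv.toContinuousLinearMap.integral_comp_comm hA
    · exact L.toContinuousLinearEquiv.toContinuousLinearMap.integrable_comp hA
    · exact integrableOn_const (by rw [hv]; exact hfin)
  rw [centerOfMass_eq, centerOfMass_eq, hi, hvr, smul_add, smul_smul, inv_mul_cancel₀ hr, one_smul,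
    map_smul]

theorem possibleRegion_isometry {l n : ℕ} (L : Loc l ≃ₗᵢ[ℝ] Loc l) (d : Loc l) (R : ℝ)
    (Z : Fin n → Loc l) :
    (fun x => L x + d) ⁻¹' possibleRegion R (fun i => L (Z i) + d) = possibleRegion R Z := by
  ext x
  simp [mem_possibleRegion, L.dist_map]

theorem volume_possibleRegion_isometry {l n : ℕ} (L : Loc l ≃ₗᵢ[ℝ] Loc l) (d : Loc l) (R : ℝ)
    (Z : Fin n → Loc l) :
    volume (possibleRegion R fun i => L (Z i) + d) = volume (possibleRegion R Z) := by
  rw [← possibleRegion_isometry L d R Z]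
  have hmp : MeasurePreserving (fun x => L x + d) (volume : Measure (Loc l)) volume :=
    (measurePreserving_add_right volume d).comp L.measurePreserving
  exact (hmp.measure_preimage (isClosed_possibleRegion _ _).measurableSet.nullMeasurableSet).symm

theorem centerOfMass_possibleRegion_isometry {l n : ℕ} (hn : 0 < n) (L : Loc l ≃ₗᵢ[ℝ] Loc l)
    (d : Loc l) {R : ℝ} {Z : Fin n → Loc l} (h : volume (possibleRegion R Z) ≠ 0) :
    centerOfMass (possibleRegion R fun i => L (Z i) + d)
      = L (centerOfMass (possibleRegion R Z)) + d := by
  rw [(centerOfMass_preimage_isometry L d (A := possibleRegion R fun i => L (Z i) + d) _ _ _).2,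
    possibleRegion_isometry]
  · rw [possibleRegion_isometry]
    exact integrableOn_id_possibleRegion hn R Z
  · rwa [volume_possibleRegion_isometry]
  · exact volume_possibleRegion_ne_top hn _ _

theorem cmEstimator_of_ne_zero {l n : ℕ} {R : ℝ} {Z : Fin n → Loc l}
    (h : volume (possibleRegion R Z) ≠ 0) :
    cmEstimator R n Z = centerOfMass (possibleRegion R Z) := by
  simp [cmEstimator, h]

theorem cmEstimator_isometry {l n : ℕ} (hn : 0 < n) (L : Loc l ≃ₗᵢ[ℝ] Loc l)
    (d : Loc l) (R : ℝ) (Z : Fin n → Loc l) :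
    cmEstimator R n (fun i => L (Z i) + d) = L (cmEstimator R n Z) + d := by
  by_cases h : volume (possibleRegion R Z) = 0
  · have h' := (volume_possibleRegion_isometry L d R Z).trans h
    have hn' : (n : ℝ) ≠ 0 := by exact_mod_cast hn.ne'
    simp [cmEstimator, h, h', Finset.sum_add_distrib, smul_add, ← Nat.cast_smul_eq_nsmul ℝ,
      smul_smul, hn']
  · have h' : volume (possibleRegion R fun i => L (Z i) + d) ≠ 0 := by
      rwa [volume_possibleRegion_isometry]
    rw [cmEstimator_of_ne_zero h, cmEstimator_of_ne_zero h',
      centerOfMass_possibleRegion_isometry hn L d h]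

theorem isEquivariantEstimator_cmEstimator {l : ℕ} (R : ℝ) :
    IsEquivariantEstimator (cmEstimator (l := l) R) :=
  ⟨measurable_cmEstimator R, fun _ hn Z d =>
    cmEstimator_isometry hn (LinearIsometryEquiv.refl ℝ (Loc l)) d R Z⟩

/-- Point reflections act on `CM(T(Z, R))` as they act on the reports. -/
theorem cmEstimator_reflect {l n : ℕ} (hn : 0 < n) (d : Loc l) (R : ℝ) (Z : Fin n → Loc l) :
    cmEstimator R n (fun i => d - Z i) = d - cmEstimator R n Z := by
  simpa [sub_eq_add_neg, add_comm] using
    cmEstimator_isometry hn (LinearIsometryEquiv.neg ℝ (E := Loc l)) d R Z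

theorem volume_possibleRegion_reflect {l n : ℕ} (d : Loc l) (R : ℝ) (Z : Fin n → Loc l) :
    volume (possibleRegion R fun i => d - Z i) = volume (possibleRegion R Z) := by
  simpa [sub_eq_add_neg, add_comm] using
    volume_possibleRegion_isometry (LinearIsometryEquiv.neg ℝ (E := Loc l)) d R Z

theorem dist_cmEstimator_le {l n : ℕ} (hn : 0 < n) {r R : ℝ} (hr : 0 < r) {Z : Fin n → Loc l}
    {z : Loc l} (hz : z ∈ possibleRegion R Z) : dist (cmEstimator r n Z) z ≤ r + R := by
  rw [mem_possibleRegion] at hz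
  by_cases h : volume (possibleRegion r Z) = 0
  · have hmem : cmEstimator r n Z ∈ Metric.closedBall z R := by
      have hn' : (n : ℝ) ≠ 0 := by exact_mod_cast hn.ne'
      simp only [cmEstimator, h, if_true, Finset.smul_sum]
      refine (convex_closedBall z R).sum_mem (fun _ _ => by positivity) (by simp [hn'])
        fun i _ => ?_
      rw [Metric.mem_closedBall, dist_comm]
      exact hz i
    exact (Metric.mem_closedBall.1 hmem).trans (by linarith)
  · rw [cmEstimator_of_ne_zero h]
    have h1 := mem_possibleRegion.1 (centerOfMass_mem_possibleRegion hn h) ⟨0, hn⟩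
    have h2 := hz ⟨0, hn⟩
    rw [dist_comm] at h2
    exact (dist_triangle _ _ _).trans (add_le_add h1 h2)

/-- The parallel axis theorem: the mean square distance from a point to a set of finite volume is
the mean square distance from the center of mass, plus the square of the distance between the two
points. -/
theorem setLIntegral_sq_dist {l : ℕ} {A : Set (Loc l)}
    (hb : Bornology.IsBounded A) (h0 : volume A ≠ 0) (a : Loc l) :
    ∫⁻ t in A, ‖a - t‖ₑ ^ 2
      = (∫⁻ t in A, ‖centerOfMass A - t‖ₑ ^ 2) + volume A * ‖a - centerOfMass A‖ₑ ^ 2 := by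
  have hfin : volume A ≠ ∞ := hb.measure_lt_top.ne
  set c := centerOfMass A with hc
  obtain ⟨K, hAK⟩ := hb.subset_closedBall 0
  have hint : ∀ f : Loc l → ℝ, Continuous f → IntegrableOn f A := fun f hf =>
    (hf.continuousOn.integrableOn_compact (isCompact_closedBall _ _)).mono_set hAK
  have hid : IntegrableOn (fun x : Loc l => x) A :=
    (continuous_id.continuousOn.integrableOn_compact (isCompact_closedBall _ _)).mono_set hAK
  have hsq : ∀ b : Loc l, ∫⁻ t in A, ‖b - t‖ₑ ^ 2 = ENNReal.ofReal (∫ t in A, ‖b - t‖ ^ 2) := by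
    intro b
    rw [ofReal_integral_eq_lintegral_ofReal (hint _ (by fun_prop))
      (Filter.Eventually.of_forall fun _ => by positivity)]
    simp_rw [ENNReal.ofReal_pow (norm_nonneg _), ofReal_norm]
  have hr : volume.real A ≠ 0 := by simp [Measure.real, ENNReal.toReal_eq_zero_iff, h0, hfin]
  have hcst : IntegrableOn (fun _ : Loc l => c) A := integrableOn_const hfin
  have hzero : ∫ t in A, (c - t) = 0 := by
    rw [integral_sub hcst hid, setIntegral_const, hc, centerOfMass_eq,
      smul_smul, mul_inv_cancel₀ hr, one_smul, sub_self]
  have hinner : ∫ t in A, inner ℝ (a - c) (c - t) = 0 := by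
    rw [integral_inner (f := fun t => c - t) (hcst.sub hid), hzero, inner_zero_right]
  have hexp : ∀ t, ‖a - t‖ ^ 2 = ‖c - t‖ ^ 2 + (‖a - c‖ ^ 2 + 2 * inner ℝ (a - c) (c - t)) := by
    intro t
    rw [show a - t = (a - c) + (c - t) by abel, norm_add_sq_real]
    ring
  have hreal : ∫ t in A, ‖a - t‖ ^ 2 = (∫ t in A, ‖c - t‖ ^ 2) + volume.real A * ‖a - c‖ ^ 2 := by
    rw [funext hexp, integral_add (hint _ (by fun_prop)) (hint _ (by fun_prop)),
      integral_add (hint _ (by fun_prop)) (hint _ (by fun_prop)), integral_const_mul, hinner,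
      setIntegral_const, smul_eq_mul]
    ring
  rw [hsq, hsq, hreal, ENNReal.ofReal_add (integral_nonneg fun _ => by positivity) (by positivity),
    ENNReal.ofReal_mul measureReal_nonneg, ofReal_measureReal hfin,
    ENNReal.ofReal_pow (norm_nonneg _), ofReal_norm]

/-! ### Mean square errors of equivariant estimators -/

/-- A shift-invariant function of a vector of points and one more point can be integrated over the
vector, with the extra point fixed, or over the vector and the extra point, with the vector pinned
by one coordinate. -/
theorem measure_mul_lintegral_of_shift_invariant {l n : ℕ} (i : Fin n) (z : Loc l)
    {F : (Fin n → Loc l) → Loc l → ℝ≥0∞} (hF : Measurable (Function.uncurry F))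
    (hinv : ∀ Z t d, F (fun i => Z i + d) (t + d) = F Z t) {K : Set (Loc l)}
    (hK : MeasurableSet K) :
    volume K * ∫⁻ Z, F Z z = ∫⁻ Z in {Z | Z i ∈ K}, ∫⁻ t, F Z t := by
  have hKi : MeasurableSet {Z : Fin n → Loc l | Z i ∈ K} := (measurable_pi_apply i) hK
  have hind : Measurable (K.indicator (1 : Loc l → ℝ≥0∞)) := measurable_one.indicator hK
  have h1 : ∫⁻ Z in {Z | Z i ∈ K}, ∫⁻ t, F Z t
      = ∫⁻ Z : Fin n → Loc l, ∫⁻ t, K.indicator 1 (Z i) * F Z t := by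
    rw [← lintegral_indicator hKi]
    refine lintegral_congr fun Z => ?_
    rw [lintegral_const_mul _ (by fun_prop)]
    by_cases hZ : Z i ∈ K
    · simp [hZ]
    · simp [hZ]
  have h2 : ∀ t, ∫⁻ Z : Fin n → Loc l, K.indicator 1 (Z i) * F Z t
      = ∫⁻ Z : Fin n → Loc l, K.indicator 1 (Z i + (t - z)) * F Z z := by
    intro t
    rw [← lintegral_add_right_eq_self _ (fun _ : Fin n => t - z)]
    refine lintegral_congr fun Z => ?_
    have := hinv Z z (t - z)
    rw [add_sub_cancel] at this
    rw [← this]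
    rfl
  rw [h1, lintegral_lintegral_swap (by fun_prop)]
  simp_rw [h2]
  rw [lintegral_lintegral_swap (by fun_prop), ← lintegral_const_mul _ (by fun_prop)]
  refine lintegral_congr fun Z => ?_
  rw [lintegral_mul_const _ (by fun_prop)]
  congr 1
  have h3 : ∀ t, Z i + (t - z) = t + (Z i - z) := fun t => by abel
  simp_rw [h3]
  rw [lintegral_add_right_eq_self (fun t => K.indicator (1 : Loc l → ℝ≥0∞) t) (Z i - z),
    lintegral_indicator_one hK]

/-- Averaging over uniform vectors in a product of balls around `z` is the same as averaging over
the possible target region of a vector pinned by one coordinate. -/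
theorem measure_mul_setLIntegral_possibleRegion {l n : ℕ} (i : Fin n) (z : Loc l) (R : ℝ)
    {F : (Fin n → Loc l) → Loc l → ℝ≥0∞} (hF : Measurable (Function.uncurry F))
    (hinv : ∀ Z t d, F (fun i => Z i + d) (t + d) = F Z t) {K : Set (Loc l)}
    (hK : MeasurableSet K) :
    volume K * ∫⁻ Z in {Z | z ∈ possibleRegion R Z}, F Z z
      = ∫⁻ Z in {Z | Z i ∈ K}, ∫⁻ t in possibleRegion R Z, F Z t := by
  have h := measure_mul_lintegral_of_shift_invariant i z
    (F := fun Z t => {p : (Fin n → Loc l) × Loc l | p.2 ∈ possibleRegion R p.1}.indicator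
      (Function.uncurry F) (Z, t))
    (hF.indicator (isClosed_setOf_mem_possibleRegion R).measurableSet) (fun Z t d => ?_) hK
  · rw [← lintegral_indicator (measurableSet_setOf_mem_possibleRegion z R)]
    simp_rw [← lintegral_indicator (isClosed_possibleRegion R _).measurableSet]
    exact h
  · have hm : t + d ∈ possibleRegion R (fun i => Z i + d) ↔ t ∈ possibleRegion R Z := by
      simp [mem_possibleRegion]
    by_cases ht : t ∈ possibleRegion R Z
    · rw [Set.indicator_of_mem (by exact hm.2 ht), Set.indicator_of_mem (by exact ht)]
      exact hinv Z t d
    · rw [Set.indicator_of_notMem (by exact fun h => ht (hm.1 h)),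
        Set.indicator_of_notMem (by exact ht)]

/-- Decomposition of the mean square error of a shift-equivariant function. Given the configuration
up to shifts, the position of the target is uniformly distributed in the possible target region, so
that this is the parallel axis theorem. -/
theorem setLIntegral_sq_dist_of_shift {l n : ℕ} (hn : 0 < n) {h : (Fin n → Loc l) → Loc l}
    (hm : Measurable h) (hs : ∀ Z d, h (fun i => Z i + d) = h Z + d) (z : Loc l) (R : ℝ) :
    ∫⁻ Z in {Z | z ∈ possibleRegion R Z}, ‖h Z - z‖ₑ ^ 2
      = (∫⁻ Z in {Z | z ∈ possibleRegion R Z}, ‖cmEstimator R n Z - z‖ₑ ^ 2)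
        + ∫⁻ Z in {Z | z ∈ possibleRegion R Z}, ‖h Z - cmEstimator R n Z‖ₑ ^ 2 := by
  have hg := measurable_cmEstimator (l := l) R n
  have hgs := (isEquivariantEstimator_cmEstimator (l := l) R).shift n hn
  -- Pinning one coordinate to any set of positive finite volume will do, such as the unit ball.
  have hK0 : volume (Metric.closedBall (0 : Loc l) 1) ≠ 0 :=
    (Metric.measure_closedBall_pos volume _ one_pos).ne'
  have hKt : volume (Metric.closedBall (0 : Loc l) 1) ≠ ∞ := measure_closedBall_lt_top.ne
  refine (ENNReal.mul_right_inj hK0 hKt).1 ?_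
  rw [mul_add]
  rw [measure_mul_setLIntegral_possibleRegion ⟨0, hn⟩ z R (F := fun Z t => ‖h Z - t‖ₑ ^ 2)
      (by fun_prop) (fun Z t d => by rw [hs, add_sub_add_right_eq_sub]) measurableSet_closedBall,
    measure_mul_setLIntegral_possibleRegion ⟨0, hn⟩ z R
      (F := fun Z t => ‖cmEstimator R n Z - t‖ₑ ^ 2)
      (by fun_prop) (fun Z t d => by rw [hgs, add_sub_add_right_eq_sub]) measurableSet_closedBall,
    measure_mul_setLIntegral_possibleRegion ⟨0, hn⟩ z R
      (F := fun Z _ => ‖h Z - cmEstimator R n Z‖ₑ ^ 2)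
      (by fun_prop) (fun Z t d => by rw [hs, hgs, add_sub_add_right_eq_sub])
      measurableSet_closedBall,
    ← lintegral_add_right]
  · refine lintegral_congr fun Z => ?_
    by_cases h0 : volume (possibleRegion R Z) = 0
    -- Where the center of mass is undefined, all three integrals over the region vanish.
    · simp [Measure.restrict_eq_zero.2 h0]
    · rw [setLIntegral_const, mul_comm _ (volume _), cmEstimator_of_ne_zero h0]
      exact setLIntegral_sq_dist (Metric.isBounded_closedBall.subset
        (possibleRegion_subset_closedBall R Z ⟨0, hn⟩)) h0 (h Z)
  · simp_rw [setLIntegral_const]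
    have := measurable_volume_possibleRegion (l := l) (n := n) R
    fun_prop

/-- The mean square error of an equivariant estimator exceeds that of `CM(T(Z, R))` by the mean
square difference of the two. -/
theorem meanSquare_eq_add {l N : ℕ} {G : Set (Loc l)} (hGfin : volume G ≠ ∞) {z : Loc l} {R : ℝ}
    (hB : Metric.closedBall z R ⊆ G) {h : Estimator l} (hh : IsEquivariantEstimator h) :
    meanSquare N G h z R = meanSquare N G (cmEstimator R) z R
      + ∫⁻ ω, ‖estimate h z R ω - estimate (cmEstimator R) z R ω‖ₑ ^ 2 ∂(sensorLaw N G z R) := by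
  have hg := measurable_cmEstimator (l := l) R
  have hm := hh.measurable
  have e1 := lintegral_sensorLaw (N := N) hGfin hB (F := fun n Z => ‖h n Z - z‖ₑ ^ 2)
    fun n => by fun_prop
  have e2 := lintegral_sensorLaw (N := N) hGfin hB
    (F := fun n Z => ‖cmEstimator R n Z - z‖ₑ ^ 2) fun n => by fun_prop
  have e3 := lintegral_sensorLaw (N := N) hGfin hB
    (F := fun n Z => ‖h n Z - cmEstimator R n Z‖ₑ ^ 2) fun n => by fun_prop
  unfold meanSquare estimate
  rw [e1, e2, e3, ← Finset.sum_add_distrib]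
  refine Finset.sum_congr rfl fun S hS => ?_
  have hS' : 0 < S.card := Finset.card_pos.2 (by simpa using hS)
  rw [← mul_add, setLIntegral_sq_dist_of_shift hS' (hm _) (hh.shift _ hS')]

theorem measurable_estimate {l N : ℕ} {g : Estimator l} (hg : ∀ n, Measurable (g n)) (z : Loc l)
    (R : ℝ) : Measurable (estimate (N := N) g z R) :=
  measurable_apply_reported hg z R

theorem ae_dist_estimate_cmEstimator_le {l N : ℕ} {G : Set (Loc l)} (hGfin : volume G ≠ ∞)
    {z : Loc l} {r R : ℝ} (hr : 0 < r) (hB : Metric.closedBall z R ⊆ G) :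
    ∀ᵐ ω ∂(sensorLaw N G z R), dist (estimate (cmEstimator r) z R ω) z ≤ r + R :=
  ae_sensorLaw hGfin hB (A := fun n => {Z | dist (cmEstimator r n Z) z ≤ r + R})
    (fun n => measurableSet_le ((measurable_cmEstimator r n).dist measurable_const)
      measurable_const)
    fun _ hn => Filter.Eventually.of_forall fun _ => dist_cmEstimator_le hn hr

theorem meanSquare_cmEstimator_ne_top {l N : ℕ} (hN : 1 ≤ N) {G : Set (Loc l)}
    (hGfin : volume G ≠ ∞) {z : Loc l} {R : ℝ} (hR : 0 < R) (hB : Metric.closedBall z R ⊆ G) :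
    meanSquare N G (cmEstimator R) z R ≠ ∞ := by
  have := isProbabilityMeasure_sensorLaw hN hGfin hR hB
  have hle : meanSquare N G (cmEstimator R) z R
      ≤ ∫⁻ _, ENNReal.ofReal (R + R) ^ 2 ∂(sensorLaw N G z R) := by
    refine lintegral_mono_ae ?_
    filter_upwards [ae_dist_estimate_cmEstimator_le hGfin hR hB] with ω hω
    gcongr
    rw [← ofReal_norm, ← dist_eq_norm]
    exact ENNReal.ofReal_le_ofReal hω
  refine (hle.trans_lt ?_).ne
  rw [lintegral_const, measure_univ, mul_one]
  exact ENNReal.pow_lt_top ENNReal.ofReal_lt_top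

/-- An equivariant estimator that is as good as `CM(T(Z, R))` for the detection radius `R` is
almost surely equal to it. -/
theorem ae_eq_cmEstimator_of_meanSquare_le {l N : ℕ} (hN : 1 ≤ N) {G : Set (Loc l)}
    (hGfin : volume G ≠ ∞) {z : Loc l} {R : ℝ} (hR : 0 < R) (hB : Metric.closedBall z R ⊆ G)
    {h : Estimator l} (hh : IsEquivariantEstimator h)
    (hle : meanSquare N G h z R ≤ meanSquare N G (cmEstimator R) z R) :
    ∀ᵐ ω ∂(sensorLaw N G z R), estimate h z R ω = estimate (cmEstimator R) z R ω := by
  rw [meanSquare_eq_add hGfin hB hh] at hle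
  have h0 := ENNReal.le_of_add_le_add_left (meanSquare_cmEstimator_ne_top hN hGfin hR hB)
    (hle.trans (add_zero _).ge)
  have h1 := measurable_estimate (N := N) hh.measurable z R
  have h2 := measurable_estimate (N := N) (measurable_cmEstimator (l := l) R) z R
  rw [nonpos_iff_eq_zero, lintegral_eq_zero_iff (by fun_prop)] at h0
  filter_upwards [h0] with ω hω
  simpa [sub_eq_zero] using hω

/-- If the true detection radius is at most `R`, the possible target region has positive volume. -/
theorem ae_volume_possibleRegion_ne_zero {l N : ℕ} {G : Set (Loc l)} (hGfin : volume G ≠ ∞)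
    {z : Loc l} {r R : ℝ} (hrR : r ≤ R) (hB : Metric.closedBall z r ⊆ G) :
    ∀ᵐ ω ∂(sensorLaw N G z r), volume (possibleRegion R (reported z r ω)) ≠ 0 := by
  refine ae_sensorLaw hGfin hB (A := fun n => {Z | volume (possibleRegion R Z) ≠ 0})
    (fun n => measurableSet_volume_possibleRegion_ne_zero R) fun n hn => ?_
  set B := {Z : Fin n → Loc l | volume (possibleRegion R Z) = 0}
  have hBm : MeasurableSet B :=
    measurableSet_eq_fun (measurable_volume_possibleRegion R) measurable_const
  -- Averaging over the position of the target instead, its position would lie in a null set.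
  have key := measure_mul_setLIntegral_possibleRegion ⟨0, hn⟩ z R
    (F := fun Z _ => B.indicator 1 Z) ((measurable_one.indicator hBm).comp measurable_fst)
    (fun Z t d => by
      have : (fun i => Z i + d) ∈ B ↔ Z ∈ B := by
        have := volume_possibleRegion_isometry (LinearIsometryEquiv.refl ℝ (Loc l)) d R Z
        simp only [LinearIsometryEquiv.coe_refl, id] at this
        simp [B, this]
      simp only [Set.indicator, this, Pi.one_apply])
    (measurableSet_closedBall (x := (0 : Loc l)) (ε := 1))
  have hz : ∀ Z : Fin n → Loc l, ∫⁻ _ in possibleRegion R Z, B.indicator 1 Z = 0 := by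
    intro Z
    rw [setLIntegral_const]
    by_cases hZ : Z ∈ B
    · rw [show volume (possibleRegion R Z) = 0 from hZ, mul_zero]
    · simp [hZ]
  simp_rw [hz, lintegral_zero] at key
  have h0 := (mul_eq_zero.1 key).resolve_left
    (Metric.measure_closedBall_pos volume _ one_pos).ne'
  rw [lintegral_indicator_one hBm, Measure.restrict_apply hBm] at h0
  refine measure_mono_null (fun Z hZ => ?_) h0
  simp only [Set.mem_compl_iff, Set.mem_ofPred_eq, Classical.not_imp, not_not] at hZ
  refine ⟨hZ.2, ?_⟩
  exact mem_possibleRegion.2 fun i => (mem_possibleRegion.1 hZ.1 i).trans hrR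

/-! ### Unbiasedness -/

/-- Positive probability for events about the observation that contain a neighborhood of a
possible full observation. -/
theorem sensorLaw_pos_of_mem_nhds {l N : ℕ} (hN : 1 ≤ N) {G : Set (Loc l)}
    (hGfin : volume G ≠ ∞) {z : Loc l} {R : ℝ} (hB : Metric.closedBall z R ⊆ G)
    {A : (n : ℕ) → Set (Fin n → Loc l)} (hA : ∀ n, MeasurableSet (A n)) {Z : Fin N → Loc l}
    (hZ : ∀ i, dist (Z i) z < R) (hAZ : A N ∈ nhds Z) :
    0 < sensorLaw N G z R {ω | reported z R ω ∈ A (detecting z R ω).card} := by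
  refine sensorLaw_pos hN hGfin hB hA (Measure.measure_pos_of_mem_nhds volume
    (Filter.inter_mem hAZ ?_)).ne'
  rw [setOf_mem_possibleRegion]
  exact set_pi_mem_nhds Set.finite_univ fun i _ =>
    Metric.closedBall_mem_nhds_of_mem (Metric.mem_ball.2 (hZ i))

theorem volume_possibleRegion_ne_zero_of_lt {l n : ℕ} {r : ℝ} {x : Loc l} {Z : Fin n → Loc l}
    (h : ∀ i, dist x (Z i) < r) : volume (possibleRegion r Z) ≠ 0 :=
  (Measure.measure_pos_of_mem_nhds volume (Filter.iInter_mem.2 fun i =>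
    Metric.closedBall_mem_nhds_of_mem (Metric.mem_ball.2 (h i)))).ne'

theorem sensorLaw_volume_possibleRegion_ne_zero_pos {l N : ℕ} (hN : 1 ≤ N) {G : Set (Loc l)}
    (hGfin : volume G ≠ ∞) {z : Loc l} {r R : ℝ} (hr : 0 < r) (hR : 0 < R)
    (hB : Metric.closedBall z R ⊆ G) :
    0 < sensorLaw N G z R {ω | volume (possibleRegion r (reported z R ω)) ≠ 0} := by
  refine sensorLaw_pos_of_mem_nhds hN hGfin hB
    (A := fun n => {Z | volume (possibleRegion r Z) ≠ 0})
    (fun n => measurableSet_volume_possibleRegion_ne_zero r) (Z := fun _ => z)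
    (fun _ => by simpa using hR) ?_
  have : (Set.univ.pi fun _ : Fin N => Metric.ball z r) ∈ nhds fun _ : Fin N => z :=
    set_pi_mem_nhds Set.finite_univ fun i _ => Metric.ball_mem_nhds z hr
  filter_upwards [this] with Z hZ
  refine volume_possibleRegion_ne_zero_of_lt (x := z) fun i => ?_
  rw [dist_comm]
  exact hZ i trivial

/-- Conditionally on an event that is invariant under the reflection of the observation at the
target, `CM(T(Z, r))` is unbiased: its law is symmetric about the target. -/
theorem isUnbiasedUnder_cond_cmEstimator {l N : ℕ} {G : Set (Loc l)}
    (hGfin : volume G ≠ ∞) {z : Loc l} {r R : ℝ} (hr : 0 < r)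
    (hB : Metric.closedBall z R ⊆ G) {A : (n : ℕ) → Set (Fin n → Loc l)}
    (hA : ∀ n, MeasurableSet (A n))
    (hAr : ∀ n Z, ((fun i => (2 : ℝ) • z - Z i) ∈ A n ↔ Z ∈ A n))
    (hpos : sensorLaw N G z R {ω | reported z R ω ∈ A (detecting z R ω).card} ≠ 0) :
    IsUnbiasedUnder ((sensorLaw N G z R)[|{ω | reported z R ω ∈ A (detecting z R ω).card}])
      (estimate (cmEstimator r) z R) z := by
  set μ := sensorLaw N G z R with hμ
  set E := {ω : Fin N → Loc l | reported z R ω ∈ A (detecting z R ω).card} with hE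
  set X := estimate (N := N) (cmEstimator r) z R with hX
  have hEm : MeasurableSet E := measurableSet_reported_mem hA z R
  have hXm : Measurable X := measurable_estimate (measurable_cmEstimator r) z R
  have hfinμ : IsFiniteMeasure μ := by rw [hμ, sensorLaw]; infer_instance
  have hprob : IsProbabilityMeasure μ[|E] := cond_isProbabilityMeasure hpos
  have hint : Integrable X μ[|E] := by
    refine Integrable.of_bound hXm.aestronglyMeasurable (r + R + ‖z‖) ?_
    filter_upwards [cond_absolutelyContinuous.ae_le
      (ae_dist_estimate_cmEstimator_le hGfin hr hB)] with ω hω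
    rw [dist_eq_norm] at hω
    calc ‖X ω‖ = ‖(X ω - z) + z‖ := by rw [sub_add_cancel]
      _ ≤ ‖X ω - z‖ + ‖z‖ := norm_add_le _ _
      _ ≤ _ := by gcongr
  have hsymm : (μ[|E]).map X = (μ[|E]).map fun ω => (2 : ℝ) • z - X ω := by
    ext B hBm
    have hXm' : Measurable fun ω => (2 : ℝ) • z - X ω := measurable_const.sub hXm
    rw [Measure.map_apply hXm hBm, Measure.map_apply hXm' hBm,
      cond_apply hEm, cond_apply hEm]
    congr 1
    have hg := measurable_cmEstimator (l := l) r
    have e1 := sensorLaw_apply (N := N) hGfin hB (A := fun n => A n ∩ cmEstimator r n ⁻¹' B)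
      fun n => (hA n).inter (hg n hBm)
    have e2 := sensorLaw_apply (N := N) hGfin hB
      (A := fun n => A n ∩ (fun Z => (2 : ℝ) • z - cmEstimator r n Z) ⁻¹' B)
      fun n => (hA n).inter ((measurable_const.sub (hg n)) hBm)
    refine e1.trans (Eq.trans ?_ e2.symm)
    refine Finset.sum_congr rfl fun S hS => ?_
    have hS' : 0 < S.card := Finset.card_pos.2 (by simpa using hS)
    congr 1
    have hrefl : MeasurePreserving
        (fun (Z : Fin S.card → Loc l) i => (2 : ℝ) • z - Z i) volume volume :=
      volume_preserving_pi fun _ => Measure.measurePreserving_sub_left volume _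
    rw [← hrefl.measure_preimage
      ((((hA _).inter (hg _ hBm)).inter
        (measurableSet_setOf_mem_possibleRegion z R)).nullMeasurableSet)]
    congr 1
    ext Z
    have h2 : z ∈ possibleRegion R (fun i => (2 : ℝ) • z - Z i) ↔ z ∈ possibleRegion R Z := by
      simp only [mem_possibleRegion, dist_eq_norm]
      refine forall_congr' fun i => ?_
      rw [show z - ((2 : ℝ) • z - Z i) = -(z - Z i) by rw [two_smul]; abel, norm_neg]
    simp only [Set.mem_preimage, Set.mem_inter_iff, Set.mem_ofPred_eq, hAr, h2,
      cmEstimator_reflect hS']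
  refine ⟨hint, ?_⟩
  have h1 : ∫ ω, X ω ∂μ[|E] = ∫ ω, ((2 : ℝ) • z - X ω) ∂μ[|E] := by
    have e1 := integral_map (μ := μ[|E]) hXm.aemeasurable
      (f := fun x => x) aestronglyMeasurable_id
    have e2 := integral_map (μ := μ[|E]) (measurable_const.sub hXm).aemeasurable
      (φ := fun ω => (2 : ℝ) • z - X ω) (f := fun x => x) aestronglyMeasurable_id
    rw [← e1, ← e2, hsymm]
  rw [integral_sub (integrable_const _) hint, integral_const, probReal_univ, one_smul,
    eq_sub_iff_add_eq, ← two_smul ℝ] at h1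
  exact smul_right_injective _ (two_ne_zero (α := ℝ)) h1

theorem isUnbiasedUnder_cmEstimator {l N : ℕ} (hN : 1 ≤ N) {G : Set (Loc l)}
    (hGfin : volume G ≠ ∞) {z : Loc l} {r R : ℝ} (hr : 0 < r) (hR : 0 < R)
    (hB : Metric.closedBall z R ⊆ G) :
    IsUnbiasedUnder (sensorLaw N G z R) (estimate (cmEstimator r) z R) z := by
  have := isProbabilityMeasure_sensorLaw hN hGfin hR hB
  have h := isUnbiasedUnder_cond_cmEstimator (N := N) hGfin hr hB (A := fun _ => Set.univ)
    (fun _ => MeasurableSet.univ) (fun _ _ => by simp) (by simp)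
  simpa using h

theorem isUnbiasedUnder_cond_centerOfMass {l N : ℕ} (hN : 1 ≤ N) {G : Set (Loc l)}
    (hGfin : volume G ≠ ∞) {z : Loc l} {r R : ℝ} (hr : 0 < r) (hR : 0 < R)
    (hB : Metric.closedBall z R ⊆ G) :
    IsUnbiasedUnder
      ((sensorLaw N G z R)[|{ω | volume (possibleRegion r (reported z R ω)) ≠ 0}])
      (fun ω => centerOfMass (possibleRegion r (reported z R ω))) z := by
  have hA : ∀ n, MeasurableSet {Z : Fin n → Loc l | volume (possibleRegion r Z) ≠ 0} :=
    fun n => measurableSet_volume_possibleRegion_ne_zero r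
  have h := isUnbiasedUnder_cond_cmEstimator (N := N) hGfin hr hB
    (A := fun n => {Z | volume (possibleRegion r Z) ≠ 0}) hA
    (fun n Z => by simp only [Set.mem_ofPred_eq, volume_possibleRegion_reflect])
    (sensorLaw_volume_possibleRegion_ne_zero_pos hN hGfin hr hR hB).ne'
  have hae : estimate (cmEstimator r) z R
      =ᵐ[(sensorLaw N G z R)[|{ω | volume (possibleRegion r (reported z R ω)) ≠ 0}]]
      fun ω => centerOfMass (possibleRegion r (reported z R ω)) := by
    filter_upwards [ae_cond_mem (measurableSet_reported_mem hA z R)] with ω hω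
    exact cmEstimator_of_ne_zero hω
  exact ⟨h.1.congr hae, (integral_congr_ae hae).symm.trans h.2⟩

/-! ### Separation of the centers of mass for two radii -/

/-- Integrals over the possible target region depend continuously on the reported locations: the
boundaries of the balls are null sets. -/
theorem continuous_setIntegral_possibleRegion {l n : ℕ} (hn : 0 < n) {r : ℝ} (hr : 0 < r)
    {E : Type*} [NormedAddCommGroup E] [NormedSpace ℝ E] {f : Loc l → E}
    (hf : Continuous f) :
    Continuous fun Z : Fin n → Loc l => ∫ x in possibleRegion r Z, f x := by
  have hm : ∀ Z : Fin n → Loc l, MeasurableSet (possibleRegion r Z) :=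
    fun Z => (isClosed_possibleRegion r Z).measurableSet
  simp_rw [← integral_indicator (hm _)]
  rw [continuous_iff_continuousAt]
  intro Z₀
  set B := Metric.closedBall (Z₀ ⟨0, hn⟩) (r + 1)
  refine continuousAt_of_dominated (bound := B.indicator fun x => ‖f x‖) ?_ ?_ ?_ ?_
  · exact Filter.Eventually.of_forall fun Z =>
      hf.aestronglyMeasurable.indicator (hm Z)
  · filter_upwards [Metric.ball_mem_nhds Z₀ one_pos] with Z hZ
    refine Filter.Eventually.of_forall fun x => ?_
    rw [norm_indicator_eq_indicator_norm]
    refine Set.indicator_le_indicator_of_subset (fun y hy => ?_) (fun _ => norm_nonneg _) x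
    rw [Metric.mem_closedBall]
    calc dist y (Z₀ ⟨0, hn⟩) ≤ dist y (Z ⟨0, hn⟩) + dist (Z ⟨0, hn⟩) (Z₀ ⟨0, hn⟩) :=
          dist_triangle _ _ _
      _ ≤ r + 1 := add_le_add (mem_possibleRegion.1 hy _)
          ((dist_le_pi_dist Z Z₀ _).trans (Metric.mem_ball.1 hZ).le)
  · exact (integrable_indicator_iff measurableSet_closedBall).2
      (hf.norm.continuousOn.integrableOn_compact (isCompact_closedBall _ _))
  · have hsph : ∀ᵐ x : Loc l, ∀ i, dist x (Z₀ i) ≠ r := by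
      rw [ae_all_iff]
      intro i
      have := Measure.addHaar_sphere_of_ne_zero volume (Z₀ i) hr.ne'
      rw [ae_iff]
      simpa [Metric.sphere] using this
    filter_upwards [hsph] with x hx
    -- Off the spheres of radius `r`, membership of `x` in the region is locally constant in `Z`.
    by_cases hlt : ∀ i, dist x (Z₀ i) < r
    · refine (continuousAt_const (y := f x)).congr ?_
      have hev : ∀ᶠ Z : Fin n → Loc l in nhds Z₀, ∀ i, dist x (Z i) < r := by
        rw [Filter.eventually_all]
        intro i
        exact (show Continuous fun Z : Fin n → Loc l => dist x (Z i) by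
          fun_prop).continuousAt.eventually_lt_const (hlt i)
      filter_upwards [hev] with Z hZ
      rw [Set.indicator_of_mem (mem_possibleRegion.2 fun i => (hZ i).le)]
    · push Not at hlt
      obtain ⟨i, hi⟩ := hlt
      refine (continuousAt_const (y := (0 : E))).congr ?_
      have hev : ∀ᶠ Z : Fin n → Loc l in nhds Z₀, r < dist x (Z i) :=
        (show Continuous fun Z : Fin n → Loc l => dist x (Z i) by
          fun_prop).continuousAt.eventually_const_lt (lt_of_le_of_ne hi (hx i).symm)
      filter_upwards [hev] with Z hZ
      rw [Set.indicator_of_notMem fun h => not_lt.2 (mem_possibleRegion.1 h i) hZ]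

theorem volume_real_possibleRegion_ne_zero {l n : ℕ} (hn : 0 < n) {r : ℝ} {Z : Fin n → Loc l}
    (h : volume (possibleRegion r Z) ≠ 0) : volume.real (possibleRegion r Z) ≠ 0 := by
  simp [Measure.real, ENNReal.toReal_eq_zero_iff, h, volume_possibleRegion_ne_top hn]

theorem continuousAt_centerOfMass_possibleRegion {l n : ℕ} (hn : 0 < n) {r : ℝ} (hr : 0 < r)
    {Z₀ : Fin n → Loc l} (h : volume (possibleRegion r Z₀) ≠ 0) :
    ContinuousAt (fun Z : Fin n → Loc l => centerOfMass (possibleRegion r Z)) Z₀ := by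
  simp only [centerOfMass_eq]
  have h1 := continuous_setIntegral_possibleRegion (l := l) hn hr
    (continuous_const (y := (1 : ℝ)))
  simp only [setIntegral_const, smul_eq_mul, mul_one] at h1
  exact (h1.continuousAt.inv₀ (volume_real_possibleRegion_ne_zero hn h)).smul
    (continuous_setIntegral_possibleRegion hn hr continuous_id).continuousAt

/-- The lens `{x | ‖x - a‖ ≤ R, ‖x + a‖ ≤ R}` is symmetric about the origin, and the ball of radius
`R` around `b` cuts off a part of it that lies in the half-space `⟪x, b⟫ < 0`. What remains has its
center of mass in the opposite half-space. -/
theorem setIntegral_lens_inter_pos {l : ℕ} {r R : ℝ} (hr : 0 < r) (hrR : r < R) {a b : Loc l}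
    (ha : ‖a‖ = r) (hb : ‖b‖ = r) (hab : inner ℝ a b = 0) :
    0 < ∫ x in (Metric.closedBall a R ∩ Metric.closedBall (-a) R) ∩ Metric.closedBall b R,
      inner ℝ b x := by
  set A := Metric.closedBall a R ∩ Metric.closedBall (-a) R with hA
  have hAm : MeasurableSet A := measurableSet_closedBall.inter measurableSet_closedBall
  have hf : Continuous fun x : Loc l => inner ℝ b x := by fun_prop
  have hint : IntegrableOn (fun x : Loc l => inner ℝ b x) A :=
    (hf.continuousOn.integrableOn_compact (isCompact_closedBall a R)).mono_set
      Set.inter_subset_left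
  have hzero : ∫ x in A, inner ℝ b x = 0 := by
    have h1 := (Measure.measurePreserving_neg (volume : Measure (Loc l))).setIntegral_preimage_emb
      (MeasurableEquiv.neg (Loc l)).measurableEmbedding (fun x => inner ℝ b x) A
    have h2 : (Neg.neg : Loc l → Loc l) ⁻¹' A = A := by
      ext x
      simp only [hA, Set.mem_preimage, Set.mem_inter_iff, Metric.mem_closedBall, dist_eq_norm]
      rw [show -x - a = -(x - -a) by abel, show -x - -a = -(x - a) by abel, norm_neg, norm_neg,
        and_comm]
    rw [h2] at h1
    simp only [inner_neg_right, integral_neg] at h1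
    linarith
  have hneg : ∀ x ∈ A \ Metric.closedBall b R, inner ℝ b x < 0 := by
    rintro x ⟨⟨h1, h2⟩, h3⟩
    rw [Metric.mem_closedBall, dist_eq_norm] at h1 h2 h3
    rw [sub_neg_eq_add] at h2
    have e1 := norm_sub_sq_real x a
    have e2 := norm_add_sq_real x a
    have e3 := norm_sub_sq_real x b
    have q1 : ‖x - a‖ ^ 2 ≤ R ^ 2 := by gcongr
    have q2 : ‖x + a‖ ^ 2 ≤ R ^ 2 := by gcongr
    have q3 : R ^ 2 < ‖x - b‖ ^ 2 := by
      have := hr.trans hrR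
      gcongr
      exact not_le.1 h3
    -- Adding the first two inequalities gives `‖x‖² + r² ≤ R²`; the third one is
    -- `R² < ‖x‖² + r² - 2 ⟪x, b⟫`.
    rw [real_inner_comm]
    rw [ha] at e1 e2
    rw [hb] at e3
    linarith
  have hpos : 0 < volume (A \ Metric.closedBall b R) := by
    -- The point `-(t / r) • b` is at distance `t` from the origin; it lies in the interior of the
    -- lens if `t² + r² < R²`, and outside of the third ball if `t + r > R`.
    obtain ⟨t, ht1, ht2⟩ := exists_between (show R - r < √(R ^ 2 - r ^ 2) from
      Real.lt_sqrt_of_sq_lt (by nlinarith))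
    have ht0 : 0 < t := by linarith
    have ht3 : t ^ 2 < R ^ 2 - r ^ 2 := (Real.lt_sqrt ht0.le).1 ht2
    have hR : 0 < R := hr.trans hrR
    have hnt : ‖(t / r) • b‖ = t := by
      rw [norm_smul, hb, Real.norm_of_nonneg (by positivity)]
      field_simp
    have hd : ∀ c : Loc l, ‖c‖ = r → inner ℝ c b = 0 → dist (-((t / r) • b)) c < R := by
      intro c hc hcb
      rw [dist_eq_norm]
      refine lt_of_pow_lt_pow_left₀ 2 hR.le ?_
      rw [norm_sub_sq_real, norm_neg, hnt, hc, inner_neg_left, inner_smul_left, real_inner_comm,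
        hcb]
      simp
      linarith
    refine Measure.measure_pos_of_mem_nhds volume (x := -((t / r) • b)) ?_
    refine Filter.inter_mem (Filter.inter_mem ?_ ?_) ?_
    · exact Metric.closedBall_mem_nhds_of_mem (Metric.mem_ball.2 (hd a ha hab))
    · exact Metric.closedBall_mem_nhds_of_mem (Metric.mem_ball.2 (hd (-a) (by rwa [norm_neg])
        (by rw [inner_neg_left, hab, neg_zero])))
    · refine Metric.isClosed_closedBall.isOpen_compl.mem_nhds ?_
      rw [Set.mem_compl_iff, Metric.mem_closedBall, not_le, dist_eq_norm,
        show -((t / r) • b) - b = -((t / r + 1) • b) by rw [add_smul, one_smul]; abel, norm_neg,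
        norm_smul, hb, Real.norm_of_nonneg (by positivity)]
      field_simp
      linarith
  have hBm : MeasurableSet (Metric.closedBall b R) := measurableSet_closedBall
  have hcut : 0 < ∫ x in A \ Metric.closedBall b R, -inner ℝ b x := by
    refine (setIntegral_pos_iff_support_of_nonneg_ae ?_ (hint.mono_set Set.sdiff_subset).neg).2 ?_
    · refine (ae_restrict_iff' (hAm.diff hBm)).2 (Filter.Eventually.of_forall fun x hx => ?_)
      have := hneg x hx
      simp only [Pi.zero_apply, Pi.neg_apply]
      linarith
    · refine hpos.trans_le (measure_mono fun x hx => ⟨?_, hx⟩)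
      exact neg_ne_zero.2 (hneg x hx).ne
  rw [integral_neg] at hcut
  have hsplit := integral_inter_add_sdiff hBm hint
  linarith

/-- Three points, of which the last may be repeated: two antipodal points on the sphere of radius
`s ‖a‖`, and the point `s • b`. -/
def triangleConfig {l : ℕ} (n : ℕ) (a b : Loc l) (s : ℝ) : Fin n → Loc l :=
  fun i => s • (if (i : ℕ) = 0 then a else if (i : ℕ) = 1 then -a else b)

theorem norm_triangleConfig {l n : ℕ} {r s : ℝ} (hs : 0 ≤ s) {a b : Loc l}
    (ha : ‖a‖ = r) (hb : ‖b‖ = r) (i : Fin n) : ‖triangleConfig n a b s i‖ = s * r := by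
  unfold triangleConfig
  rw [norm_smul, Real.norm_of_nonneg hs]
  split_ifs <;> simp [ha, hb]

theorem possibleRegion_triangleConfig {l n : ℕ} (hn : 3 ≤ n) (R s : ℝ) (a b : Loc l) :
    possibleRegion R (triangleConfig n a b s) =
      (Metric.closedBall (s • a) R ∩ Metric.closedBall (-(s • a)) R)
        ∩ Metric.closedBall (s • b) R := by
  ext x
  simp only [mem_possibleRegion, triangleConfig, Set.mem_inter_iff, Metric.mem_closedBall]
  constructor
  · intro h
    have h0 := h ⟨0, by omega⟩
    have h1 := h ⟨1, by omega⟩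
    have h2 := h ⟨2, by omega⟩
    simp only [if_true, one_ne_zero, if_false, OfNat.ofNat_ne_zero, OfNat.ofNat_ne_one,
      smul_neg] at h0 h1 h2
    exact ⟨⟨h0, h1⟩, h2⟩
  · rintro ⟨⟨h0, h1⟩, h2⟩ i
    split_ifs
    · exact h0
    · rwa [smul_neg]
    · exact h2

/-- Two different radii have different centers of mass at some configuration of locations. As the
circumradius of a triangle with a diameter as one side tends to `r`, the region for the radius `r`
shrinks to the circumcenter, but the center of mass for the radius `R > r` stays away from it. -/
theorem exists_centerOfMass_possibleRegion_ne {l n : ℕ} (hl : 2 ≤ l) (hn : 3 ≤ n) {r R : ℝ}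
    (hr : 0 < r) (hrR : r < R) :
    ∃ Z : Fin n → Loc l, (∀ i, ‖Z i‖ < r) ∧
      centerOfMass (possibleRegion r Z) ≠ centerOfMass (possibleRegion R Z) := by
  have hn0 : 0 < n := by omega
  have hR : 0 < R := hr.trans hrR
  set a : Loc l := EuclideanSpace.single ⟨0, by omega⟩ r with ha_def
  set b : Loc l := EuclideanSpace.single ⟨1, by omega⟩ r with hb_def
  have ha : ‖a‖ = r := by simp [ha_def, abs_of_pos hr]
  have hb : ‖b‖ = r := by simp [hb_def, abs_of_pos hr]
  have hab : inner ℝ a b = 0 := by simp [ha_def, hb_def, EuclideanSpace.inner_single_left]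
  set Z : ℝ → Fin n → Loc l := triangleConfig n a b with hZ
  have hZcont : Continuous Z := by
    refine continuous_pi fun i => ?_
    simp only [hZ, triangleConfig]
    fun_prop
  have hnorm : ∀ s, 0 ≤ s → ∀ i, ‖Z s i‖ = s * r := fun s hs i => norm_triangleConfig hs ha hb i
  have hvol : ∀ s ρ, 0 ≤ s → s * r < ρ → volume (possibleRegion ρ (Z s)) ≠ 0 := by
    intro s ρ hs hsρ
    refine volume_possibleRegion_ne_zero_of_lt (x := 0) fun i => ?_
    rwa [dist_zero_left, hnorm s hs]
  by_contra hcon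
  push Not at hcon
  have heq : ∀ s ∈ Set.Ioo (0 : ℝ) 1, centerOfMass (possibleRegion r (Z s))
      = centerOfMass (possibleRegion R (Z s)) := by
    intro s hs
    refine hcon (Z s) fun i => ?_
    rw [hnorm s hs.1.le]
    nlinarith [hs.2]
  have hsmall : ∀ s ∈ Set.Ioo (0 : ℝ) 1,
      ‖centerOfMass (possibleRegion r (Z s))‖ ≤ √(r ^ 2 - (s * r) ^ 2) := by
    intro s hs
    have hmem := centerOfMass_mem_possibleRegion hn0
      (hvol s r hs.1.le (by nlinarith [hs.2]))
    set c := centerOfMass (possibleRegion r (Z s))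
    rw [hZ, possibleRegion_triangleConfig hn] at hmem
    obtain ⟨⟨h1, h2⟩, -⟩ := hmem
    rw [Metric.mem_closedBall, dist_eq_norm] at h1 h2
    rw [sub_neg_eq_add] at h2
    have hp := parallelogram_law_with_norm ℝ c (s • a)
    have hsa : ‖s • a‖ = s * r := by rw [norm_smul, ha, Real.norm_of_nonneg hs.1.le]
    rw [hsa] at hp
    refine Real.le_sqrt_of_sq_le ?_
    nlinarith [mul_self_le_mul_self (norm_nonneg _) h1, mul_self_le_mul_self (norm_nonneg _) h2]
  have hioo : Set.Ioo (0 : ℝ) 1 ∈ nhdsWithin (1 : ℝ) (Set.Iio 1) := Ioo_mem_nhdsLT one_pos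
  have hlim0 : Filter.Tendsto (fun s => centerOfMass (possibleRegion R (Z s)))
      (nhdsWithin (1 : ℝ) (Set.Iio 1)) (nhds 0) := by
    have hsq : Filter.Tendsto (fun s : ℝ => √(r ^ 2 - (s * r) ^ 2))
        (nhdsWithin (1 : ℝ) (Set.Iio 1)) (nhds 0) := by
      have hc : Continuous fun s : ℝ => √(r ^ 2 - (s * r) ^ 2) := by fun_prop
      have := (hc.tendsto 1).mono_left (nhdsWithin_le_nhds (s := Set.Iio 1))
      simpa using this
    refine squeeze_zero_norm' ?_ hsq
    filter_upwards [hioo] with s hs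
    rw [← heq s hs]
    exact hsmall s hs
  have hv1 : volume (possibleRegion R (Z 1)) ≠ 0 := hvol 1 R zero_le_one (by rwa [one_mul])
  have hlim1 : Filter.Tendsto (fun s => centerOfMass (possibleRegion R (Z s)))
      (nhdsWithin (1 : ℝ) (Set.Iio 1)) (nhds (centerOfMass (possibleRegion R (Z 1)))) :=
    Filter.Tendsto.mono_left (ContinuousAt.comp
      (f := Z) (continuousAt_centerOfMass_possibleRegion hn0 hR hv1) hZcont.continuousAt)
      nhdsWithin_le_nhds
  have hzero : centerOfMass (possibleRegion R (Z 1)) = 0 := tendsto_nhds_unique hlim1 hlim0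
  have hpos := setIntegral_lens_inter_pos hr hrR ha hb hab
  have hreg := possibleRegion_triangleConfig hn R 1 a b
  simp only [one_smul] at hreg
  rw [← hreg] at hpos
  rw [integral_inner (f := fun x => x) (integrableOn_id_possibleRegion hn0 R _)] at hpos
  rw [centerOfMass_eq, smul_eq_zero, inv_eq_zero] at hzero
  have hint := hzero.resolve_left (volume_real_possibleRegion_ne_zero hn0 hv1)
  rw [hint, inner_zero_right] at hpos
  exact hpos.false

/-- Observations for which two radii give different centers of mass. -/
def differSet {l : ℕ} (r R : ℝ) (n : ℕ) : Set (Fin n → Loc l) :=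
  {Z | volume (possibleRegion r Z) ≠ 0 ∧ volume (possibleRegion R Z) ≠ 0 ∧
    centerOfMass (possibleRegion r Z) ≠ centerOfMass (possibleRegion R Z)}

theorem measurableSet_differSet {l : ℕ} (r R : ℝ) (n : ℕ) :
    MeasurableSet (differSet (l := l) r R n) :=
  (measurableSet_volume_possibleRegion_ne_zero r).inter
    ((measurableSet_volume_possibleRegion_ne_zero R).inter
      (measurableSet_eq_fun (measurable_centerOfMass_possibleRegion r)
        (measurable_centerOfMass_possibleRegion R)).compl)

theorem volume_differSet_inter_ne_zero {l n : ℕ} (hl : 2 ≤ l) (hn : 3 ≤ n) {r R : ℝ}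
    (hr : 0 < r) (hrR : r < R) (z : Loc l) {ρ : ℝ} (hρ : r ≤ ρ) :
    volume (differSet r R n ∩ {Z : Fin n → Loc l | z ∈ possibleRegion ρ Z}) ≠ 0 := by
  have hn0 : 0 < n := by omega
  obtain ⟨Z, hZ, hne⟩ := exists_centerOfMass_possibleRegion_ne hl hn hr hrR
  set W : Fin n → Loc l := fun i => Z i + z with hW
  have hnear : ∀ᶠ Y : Fin n → Loc l in nhds W, ∀ i, dist z (Y i) < r := by
    rw [Filter.eventually_all]
    intro i
    refine (show Continuous fun Y : Fin n → Loc l => dist z (Y i) by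
      fun_prop).continuousAt.eventually_lt_const ?_
    simpa [hW] using hZ i
  have hv : ∀ t, r ≤ t → ∀ Y : Fin n → Loc l, (∀ i, dist z (Y i) < r) →
      volume (possibleRegion t Y) ≠ 0 := fun t ht Y hY =>
    volume_possibleRegion_ne_zero_of_lt (x := z) fun i => (hY i).trans_le ht
  have hWn := hnear.self_of_nhds
  have hshift : ∀ t, r ≤ t → centerOfMass (possibleRegion t W)
      = centerOfMass (possibleRegion t Z) + z := fun t ht =>
    centerOfMass_possibleRegion_isometry hn0 (LinearIsometryEquiv.refl ℝ (Loc l)) z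
      (volume_possibleRegion_ne_zero_of_lt (x := 0) fun i => by
        rw [dist_zero_left]; exact (hZ i).trans_le ht)
  have hneW : centerOfMass (possibleRegion r W) ≠ centerOfMass (possibleRegion R W) := by
    rw [hshift r le_rfl, hshift R hrR.le]
    exact fun h => hne (add_right_cancel h)
  have hne' := ((continuousAt_centerOfMass_possibleRegion hn0 hr (hv r le_rfl W hWn)).sub
    (continuousAt_centerOfMass_possibleRegion hn0 (hr.trans hrR)
      (hv R hrR.le W hWn))).eventually_ne (sub_ne_zero.2 hneW)
  refine (Measure.measure_pos_of_mem_nhds volume (x := W) ?_).ne'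
  filter_upwards [hnear, hne'] with Y h1 h2
  exact ⟨⟨hv r le_rfl Y h1, hv R hrR.le Y h1, sub_ne_zero.1 h2⟩,
    mem_possibleRegion.2 fun i => (h1 i).le.trans hρ⟩

/-! ### MVU estimators -/

/-- Almost sure agreement of two estimators at a target position means agreement almost everywhere
in a product of balls. -/
theorem volume_ne_inter_eq_zero_of_ae_eq {l N : ℕ} (hN : 1 ≤ N) {G : Set (Loc l)}
    (hGfin : volume G ≠ ∞) {z : Loc l} {R : ℝ} (hB : Metric.closedBall z R ⊆ G)
    {g h : Estimator l} (hg : ∀ n, Measurable (g n)) (hh : ∀ n, Measurable (h n))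
    (hae : ∀ᵐ ω ∂(sensorLaw N G z R), estimate g z R ω = estimate h z R ω) :
    volume ({Z | g N Z ≠ h N Z} ∩ {Z : Fin N → Loc l | z ∈ possibleRegion R Z}) = 0 := by
  by_contra hne
  exact (sensorLaw_pos hN hGfin hB (A := fun n => {Z | g n Z ≠ h n Z})
    (fun n => (measurableSet_eq_fun (hg n) (hh n)).compl) hne).ne' hae

/-- For equivariant estimators, almost everywhere agreement does not depend on the position of the
target. -/
theorem volume_ne_inter_shift {l n : ℕ} (hn : 0 < n) {g h : Estimator l}
    (hg : IsEquivariantEstimator g) (hh : IsEquivariantEstimator h) (z z' : Loc l) (R : ℝ) :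
    volume ({Z | g n Z ≠ h n Z} ∩ {Z : Fin n → Loc l | z' ∈ possibleRegion R Z})
      = volume ({Z | g n Z ≠ h n Z} ∩ {Z : Fin n → Loc l | z ∈ possibleRegion R Z}) := by
  rw [← measure_preimage_add_right volume (fun _ : Fin n => z' - z)]
  congr 1
  ext Z
  have e : (Z + fun _ => z' - z) = fun i => Z i + (z' - z) := rfl
  have hm : z' ∈ possibleRegion R (fun i => Z i + (z' - z)) ↔ z ∈ possibleRegion R Z := by
    simp only [mem_possibleRegion, dist_eq_norm]
    refine forall_congr' fun i => ?_
    rw [show z' - (Z i + (z' - z)) = z - Z i by abel]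
  simp only [Set.mem_preimage, Set.mem_inter_iff, Set.mem_ofPred_eq, e, hm, hg.shift n hn,
    hh.shift n hn, ne_eq, add_left_inj]

theorem closedBall_subset_of_mem_paramSet {l : ℕ} {G : Set (Loc l)} {ρ : Set ℝ}
    {θ : Loc l × ℝ} (h : θ ∈ paramSet G ρ) : Metric.closedBall θ.1 θ.2 ⊆ G :=
  (Metric.closedBall_subset_closedBall (by linarith [h.2.1])).trans h.2.2

theorem isUnbiasedOn_cmEstimator {l N : ℕ} (hN : 1 ≤ N) {G : Set (Loc l)}
    (hGfin : volume G ≠ ∞) {r : ℝ} (hr : 0 < r) (ρ : Set ℝ) :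
    IsUnbiasedOn N G (paramSet G ρ) (cmEstimator r) :=
  ⟨isEquivariantEstimator_cmEstimator r, fun _ hθ =>
    isUnbiasedUnder_cmEstimator hN hGfin hr hθ.2.1 (closedBall_subset_of_mem_paramSet hθ)⟩

theorem isMVU_cmEstimator {l N : ℕ} (hN : 1 ≤ N) {G : Set (Loc l)}
    (hGfin : volume G ≠ ∞) {R : ℝ} (hR : 0 < R) :
    IsMVU N G (paramSet G {R}) (cmEstimator R) := by
  refine ⟨isUnbiasedOn_cmEstimator hN hGfin hR _, fun h hh θ hθ => ?_⟩
  obtain rfl : θ.2 = R := hθ.1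
  rw [meanSquare_eq_add hGfin (closedBall_subset_of_mem_paramSet hθ) hh.1]
  exact le_self_add

/-- An MVU estimator agrees with `CM(T(Z, R))` at every parameter with detection radius `R`,
because `CM(T(Z, R))` is unbiased for all radii. -/
theorem IsMVU.ae_eq_cmEstimator {l N : ℕ} (hN : 1 ≤ N) {G : Set (Loc l)}
    (hGfin : volume G ≠ ∞) {ρ : Set ℝ} {g : Estimator l} (hg : IsMVU N G (paramSet G ρ) g)
    {θ : Loc l × ℝ} (hθ : θ ∈ paramSet G ρ) :
    ∀ᵐ ω ∂(sensorLaw N G θ.1 θ.2),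
      estimate g θ.1 θ.2 ω = estimate (cmEstimator θ.2) θ.1 θ.2 ω :=
  ae_eq_cmEstimator_of_meanSquare_le hN hGfin hθ.2.1 (closedBall_subset_of_mem_paramSet hθ) hg.1.1
    (hg.2 _ (isUnbiasedOn_cmEstimator hN hGfin hθ.2.1 ρ) θ hθ)

theorem sensorLaw_differSet_pos {l N : ℕ} (hl : 2 ≤ l) (hN : 3 ≤ N) {G : Set (Loc l)}
    (hGfin : volume G ≠ ∞) {r R : ℝ} (hrR : r ≠ R) (hr : 0 < r) (hR : 0 < R) {z : Loc l} {ρ : ℝ}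
    (hρ : ρ = r ∨ ρ = R) (hB : Metric.closedBall z ρ ⊆ G) :
    0 < sensorLaw N G z ρ {ω | reported z ρ ω ∈ differSet r R (detecting z ρ ω).card} := by
  refine sensorLaw_pos (by omega) hGfin hB (fun n => measurableSet_differSet r R n) ?_
  have hsymm : differSet (l := l) r R N = differSet R r N := by
    ext Z
    simp only [differSet, Set.mem_ofPred_eq]
    rw [ne_comm (a := centerOfMass (possibleRegion r Z))]
    tauto
  rcases lt_or_gt_of_ne hrR with h | h
  · exact volume_differSet_inter_ne_zero hl hN hr h z (by rcases hρ with rfl | rfl <;> linarith)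
  · rw [hsymm]
    exact volume_differSet_inter_ne_zero hl hN hR h z (by rcases hρ with rfl | rfl <;> linarith)

/-- An MVU estimator for two radii would have to agree with both centers of mass. -/
theorem not_isMVU_of_two_radii {l N : ℕ} (hl : 2 ≤ l) (hN : 3 ≤ N) {G : Set (Loc l)}
    (hGfin : volume G ≠ ∞) {ρ : Set ℝ} {θ θ' : Loc l × ℝ} (hθ : θ ∈ paramSet G ρ)
    (hθ' : θ' ∈ paramSet G ρ) (hlt : θ.2 < θ'.2) (g : Estimator l) :
    ¬ IsMVU N G (paramSet G ρ) g := by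
  intro hg
  have hN1 : 1 ≤ N := by omega
  have hcm := fun r => isEquivariantEstimator_cmEstimator (l := l) r
  have h1 := volume_ne_inter_eq_zero_of_ae_eq hN1 hGfin (closedBall_subset_of_mem_paramSet hθ)
    hg.1.1.measurable (hcm θ.2).measurable (hg.ae_eq_cmEstimator hN1 hGfin hθ)
  have h2 := volume_ne_inter_eq_zero_of_ae_eq hN1 hGfin (closedBall_subset_of_mem_paramSet hθ')
    hg.1.1.measurable (hcm θ'.2).measurable (hg.ae_eq_cmEstimator hN1 hGfin hθ')
  -- Move the agreement at the second target position to the first one, so that both hold for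
  -- vectors in a common product of balls.
  rw [← volume_ne_inter_shift hN1 hg.1.1 (hcm θ'.2) θ'.1 θ.1] at h2
  refine volume_differSet_inter_ne_zero hl hN hθ.2.1 hlt θ.1 le_rfl
    (measure_mono_null ?_ (measure_union_null h1 h2))
  rintro Z ⟨⟨hv1, hv2, hne⟩, hZ⟩
  have hZ' : θ.1 ∈ possibleRegion θ'.2 Z :=
    mem_possibleRegion.2 fun i => (mem_possibleRegion.1 hZ i).trans hlt.le
  rw [← cmEstimator_of_ne_zero hv1, ← cmEstimator_of_ne_zero hv2] at hne
  by_cases hgZ : g N Z = cmEstimator θ.2 N Z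
  · exact Or.inr ⟨by rw [Set.mem_ofPred_eq, hgZ]; exact hne, hZ'⟩
  · exact Or.inl ⟨hgZ, hZ⟩

theorem mainTheorem2 (l N : ℕ) (hl : 1 ≤ l) (hN : 1 ≤ N) (G : Set (Loc l))
    (hG : MeasurableSet G) (hGfin : volume G ≠ ∞) :
    -- for every `R`, the estimator `CM(T(Z, R))` is unbiased, whatever the true radius is
    (∀ R : ℝ, 0 < R →
      IsUnbiasedOn N G (paramSet G Set.univ) (cmEstimator R)) ∧
    -- the same, conditionally on `T(Z, R)` having a center of mass; this condition has positive
    -- probability, and it holds almost surely if the true radius `θ.2` is at most `R`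
    (∀ R : ℝ, 0 < R → ∀ θ ∈ paramSet G Set.univ,
      0 < sensorLaw N G θ.1 θ.2
        {ω | volume (possibleRegion R (reported θ.1 θ.2 ω)) ≠ 0} ∧
      IsUnbiasedUnder
        ((sensorLaw N G θ.1 θ.2)[|{ω | volume (possibleRegion R (reported θ.1 θ.2 ω)) ≠ 0}])
        (fun ω => centerOfMass (possibleRegion R (reported θ.1 θ.2 ω))) θ.1 ∧
      (θ.2 ≤ R → ∀ᵐ ω ∂(sensorLaw N G θ.1 θ.2),
        volume (possibleRegion R (reported θ.1 θ.2 ω)) ≠ 0)) ∧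
    -- for known radius `R`, the estimator `CM(T(Z, R))` is the unique MVU estimator
    (∀ R : ℝ, 0 < R →
      IsMVU N G (paramSet G {R}) (cmEstimator R) ∧
      ∀ h : Estimator l, IsMVU N G (paramSet G {R}) h →
        ∀ θ ∈ paramSet G {R}, ∀ᵐ ω ∂(sensorLaw N G θ.1 θ.2),
          estimate h θ.1 θ.2 ω = centerOfMass (possibleRegion R (reported θ.1 θ.2 ω))) ∧
    -- different radii give different estimators, and no MVU estimator exists for unknown radius
    (2 ≤ l → 3 ≤ N → ∀ R₁ R₂ : ℝ, R₁ ≠ R₂ →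
      (paramSet G {R₁}).Nonempty → (paramSet G {R₂}).Nonempty →
      (∀ θ ∈ paramSet G {R₁, R₂},
        0 < sensorLaw N G θ.1 θ.2
          {ω | volume (possibleRegion R₁ (reported θ.1 θ.2 ω)) ≠ 0 ∧
            volume (possibleRegion R₂ (reported θ.1 θ.2 ω)) ≠ 0 ∧
            centerOfMass (possibleRegion R₁ (reported θ.1 θ.2 ω)) ≠
              centerOfMass (possibleRegion R₂ (reported θ.1 θ.2 ω))}) ∧
      ∀ ρ : Set ℝ, R₁ ∈ ρ → R₂ ∈ ρ →
        ¬ ∃ g : Estimator l, IsMVU N G (paramSet G ρ) g) := by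
  refine ⟨fun R hR => isUnbiasedOn_cmEstimator hN hGfin hR _, fun R hR θ hθ => ?_,
    fun R hR => ⟨isMVU_cmEstimator hN hGfin hR, fun h hh θ hθ => ?_⟩,
    fun hl2 hN3 R₁ R₂ hne hp₁ hp₂ => ?_⟩
  · have hB := closedBall_subset_of_mem_paramSet hθ
    exact ⟨sensorLaw_volume_possibleRegion_ne_zero_pos hN hGfin hR hθ.2.1 hB,
      isUnbiasedUnder_cond_centerOfMass hN hGfin hR hθ.2.1 hB,
      fun hle => ae_volume_possibleRegion_ne_zero hGfin hle hB⟩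
  · obtain rfl : θ.2 = R := hθ.1
    filter_upwards [hh.ae_eq_cmEstimator hN hGfin hθ,
      ae_volume_possibleRegion_ne_zero hGfin le_rfl (closedBall_subset_of_mem_paramSet hθ)]
      with ω h1 h2
    exact h1.trans (cmEstimator_of_ne_zero h2)
  · obtain ⟨θ₁, hθ₁, hpos₁, hsub₁⟩ := hp₁
    obtain ⟨θ₂, hθ₂, hpos₂, hsub₂⟩ := hp₂
    rw [Set.mem_singleton_iff] at hθ₁ hθ₂
    subst hθ₁ hθ₂
    refine ⟨fun θ hθ => sensorLaw_differSet_pos hl2 hN3 hGfin hne hpos₁ hpos₂ hθ.1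
      (closedBall_subset_of_mem_paramSet hθ), fun ρ hρ₁ hρ₂ => ?_⟩
    rintro ⟨g, hg⟩
    rcases lt_or_gt_of_ne hne with h | h
    · exact not_isMVU_of_two_radii hl2 hN3 hGfin ⟨hρ₁, hpos₁, hsub₁⟩ ⟨hρ₂, hpos₂, hsub₂⟩ h g hg
    · exact not_isMVU_of_two_radii hl2 hN3 hGfin ⟨hρ₂, hpos₂, hsub₂⟩ ⟨hρ₁, hpos₁, hsub₁⟩ h g hg
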